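/- Let $n\ge 1$ and let $Mb_n$ be the set of crossingless connections of the M\"obius band: systems of $n$ pairwise disjoint arcs joining $2n$ marked points on the boundary in pairs, without closed components, up to isotopy fixing the boundary. For $m_i,m_j\in Mb_n$, glue an inner M\"obius band containing $m_i$ to an outer one containing $m_j$ along their boundary circles, matching the labels of the marked points. The result is a collection of disjoint simple closed curves on a Klein bottle, and $\langle m_i,m_j\rangle\in\mathbb Z[d,w,x,y,z]$ is the product over these curves of the variable given by the type of the curve: $d$ for a homotopically trivial curve, $x$ for one that intersects (essentially) the inner crosscap only, $y$ for one that intersects the outer crosscap only, $w$ for one that intersects both crosscaps, and $z$ for one that separates the two crosscaps. Let $G_n=(\langle m_i,m_j\rangle)_{m_i,m_j\in Mb_n}$ be the Gram matrix of type $Mb$. Then, in $\mathbb Z[d,w,x,y,z]$, the determinant $\det G_n$ is divisible by $$\bigl(w(d+z)-2xy\bigr)^{\binom{2n}{n-1}} .$$ -/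

import Mathlib

namespace KleinGram

/-!
Model. The universal cover of the Moebius band is the strip `ℝ × [0,1]`; with `2 * n` marked points
on the boundary circle, the coordinate of `ℝ` is scaled so that the boundary has length `2 * n` and
the marked points lift to the integer points of the two boundary lines. The group of deck
transformations is infinite cyclic, generated by the glide reflection `(s, t) ↦ (s + n, 1 - t)`,
and a properly embedded arc of the band can be isotoped off the crosscap iff its lifts join points
of the same boundary line of the strip; otherwise it passes through the crosscap once.
-/

/-- Lifts of the marked points to the boundary of the strip: `(s, false)` is the point `s` of the
line `t = 0`, and `(s, true)` is the point `s` of the line `t = 1`. -/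
abbrev StripPt : Type := ℤ × Bool

/-- The generator `(s, t) ↦ (s + n, 1 - t)` of the group of deck transformations, on lifts of
marked points. -/
def deck (n : ℕ) (p : StripPt) : StripPt := (p.1 + n, !p.2)

/-- The label of the marked point below a lift. Two lifts have the same label iff they differ by
a deck transformation; the point `(s, false)` has label `s`. -/
def label (n : ℕ) (p : StripPt) : ZMod (2 * n) :=
  (((if p.2 then p.1 + n else p.1 : ℤ)) : ZMod (2 * n))

/-- The order in which the boundary of the strip is traversed: the line `t = 0` from left to right,
then the line `t = 1` from right to left. -/
def Before : StripPt → StripPt → Prop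
  | (s, false), (t, false) => s < t
  | (_, false), (_, true) => True
  | (_, true), (_, false) => False
  | (s, true), (t, true) => t < s

/-- Crossingless connections of `2 * n` marked points on the boundary of the Moebius band, up to
isotopy fixing the boundary. A system of `n` pairwise disjoint arcs joining the marked points is
determined up to isotopy by its preimage in the strip, and that preimage, the strip being a disc
without two boundary points, by the pairs of lifts that its arcs join. Such a pairing comes from
a system of arcs iff it is invariant under deck transformations and no two of its pairs separate
each other on the boundary of the strip. -/
@[ext]
structure Connection (n : ℕ) where
  /-- the other end of the lifted arc that ends at a given point -/
  mate : StripPt → StripPt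
  mate_mate : ∀ p, mate (mate p) = p
  mate_ne : ∀ p, mate p ≠ p
  mate_deck : ∀ p, mate (deck n p) = deck n (mate p)
  noncrossing : ∀ p q, ¬ (Before p q ∧ Before q (mate p) ∧ Before (mate p) (mate q))

namespace Connection

variable {n : ℕ}

theorem mate_deck_deck (m : Connection n) (a : ℤ) (s : Bool) :
    m.mate (a + 2 * n, s) = ((m.mate (a, s)).1 + 2 * n, (m.mate (a, s)).2) := by
  have h := m.mate_deck (deck n (a, s))
  rw [m.mate_deck (a, s)] at h
  simp only [deck, Bool.not_not] at h
  rw [show a + 2 * (n : ℤ) = a + n + n by ring, h]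
  exact Prod.ext (by simp only; ring) rfl

theorem mate_shift (m : Connection n) (k a : ℤ) (s : Bool) :
    m.mate (a + k * (2 * n), s) = ((m.mate (a, s)).1 + k * (2 * n), (m.mate (a, s)).2) := by
  induction k with
  | zero => simp
  | succ k ih =>
    have h := m.mate_deck_deck (a + k * (2 * n)) s
    rw [ih] at h
    rw [show a + ((k : ℤ) + 1) * (2 * n) = a + k * (2 * n) + 2 * n by ring, h]
    exact Prod.ext (by simp only; ring) rfl
  | pred k ih =>
    have h := m.mate_deck_deck (a + (-(k : ℤ) - 1) * (2 * n)) s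
    rw [show a + (-(k : ℤ) - 1) * (2 * n) + 2 * n = a + -(k : ℤ) * (2 * n) by ring, ih] at h
    have h1 := congrArg Prod.fst h
    have h2 := congrArg Prod.snd h
    simp only at h1 h2
    exact Prod.ext (by simp only; linarith) h2.symm

theorem mate_bound [NeZero n] (m : Connection n) (a : ℤ) :
    a - 2 * n ≤ (m.mate (a, false)).1 ∧ (m.mate (a, false)).1 ≤ a + 2 * n := by
  have hn : 0 < n := Nat.pos_of_ne_zero (NeZero.ne n)
  have hm := m.mate_mate (a, false)
  have h2 := m.mate_deck_deck a false
  have hd := m.mate_deck (a, false)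
  obtain ⟨⟨b, t⟩, hb⟩ : ∃ q, m.mate (a, false) = q := ⟨_, rfl⟩
  rw [hb] at hm h2 hd ⊢
  cases t
  · have h3 := m.mate_deck_deck b false
    rw [hm] at h3
    simp only at h2 h3
    have c1 := m.noncrossing (a, false) (a + 2 * n, false)
    have c2 := m.noncrossing (b, false) (b + 2 * n, false)
    rw [hb, h2] at c1
    rw [hm, h3] at c2
    simp only [Before] at c1 c2 ⊢
    omega
  · have he := m.mate_deck (b, true)
    rw [hm] at he
    simp only [deck, Bool.not_false, Bool.not_true] at hd he
    have c1 := m.noncrossing (a, false) (b + n, false)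
    have c2 := m.noncrossing (b + n, false) (a, false)
    rw [hb, he] at c1
    rw [hb, he] at c2
    simp only [Before, true_and] at c1 c2 ⊢
    omega

/-- There are finitely many crossingless connections. -/
instance [NeZero n] : Finite (Connection n) := by
  have hn : 0 < n := Nat.pos_of_ne_zero (NeZero.ne n)
  let f : Connection n → Fin (2 * n) → Set.Icc (-(2 * n : ℤ)) (4 * n) × Bool := fun m i =>
    (⟨(m.mate ((i : ℤ), false)).1, by
      have h := m.mate_bound (i : ℤ)
      have hi := i.2
      constructor <;> omega⟩, (m.mate ((i : ℤ), false)).2)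
  refine Finite.of_injective f fun m m' h => ?_
  have key : ∀ a : ℤ, m.mate (a, false) = m'.mate (a, false) := by
    intro a
    have hpos : (0 : ℤ) < 2 * n := by omega
    have h0 := Int.emod_nonneg a hpos.ne'
    have h1 := Int.emod_lt_of_pos a hpos
    have hi := congrFun h ⟨(a % (2 * n)).toNat, by omega⟩
    simp only [f, Prod.mk.injEq, Subtype.mk.injEq, Int.toNat_of_nonneg h0] at hi
    have ha : a = a % (2 * n) + a / (2 * n) * (2 * n) := by
      rw [mul_comm (a / _)]; exact (Int.emod_add_mul_ediv a (2 * n)).symm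
    rw [ha, m.mate_shift, m'.mate_shift, hi.1, hi.2]
  ext1
  funext p
  obtain ⟨a, s⟩ := p
  cases s
  · exact key a
  · have e : ((a, true) : StripPt) = deck n (a - n, false) := by simp [deck]
    rw [e, m.mate_deck, m'.mate_deck, key]

noncomputable instance [NeZero n] : Fintype (Connection n) := Fintype.ofFinite _

/-- The arc of `m` that ends at the marked point `i` passes through the crosscap: its lifts join
the two boundary lines of the strip. -/
def Crosses (m : Connection n) (i : ZMod (2 * n)) : Prop :=
  ∃ p : StripPt, label n p = i ∧ (m.mate p).2 ≠ p.2

/-- The marked points `i` and `j` are the ends of an arc of `m`. -/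
def Joins (m : Connection n) (i j : ZMod (2 * n)) : Prop :=
  ∃ p : StripPt, label n p = i ∧ label n (m.mate p) = j

end Connection

/-- The five types of simple closed curves on the Klein bottle obtained by gluing an inner and an
outer Moebius band along their boundaries: `d` is homotopically trivial, `w` intersects both
crosscaps, `x` intersects the inner one only, `y` intersects the outer one only, and `z` separates
the two crosscaps. -/
inductive CurveType : Type
  | d | w | x | y | z

variable {n : ℕ}

/-- The graph on the marked points whose edges are the arcs of `m₁` and of `m₂`. -/
def glueGraph (m₁ m₂ : Connection n) : SimpleGraph (ZMod (2 * n)) :=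
  SimpleGraph.fromRel fun i j => m₁.Joins i j ∨ m₂.Joins i j

/-- The closed curves on the Klein bottle formed by `m₁` in the inner and `m₂` in the outer Moebius
band, glued along the boundary with the labels of the marked points matching: each consists of the
arcs in one connected component of the graph of all arcs. -/
abbrev ClosedCurve (m₁ m₂ : Connection n) : Type := (glueGraph m₁ m₂).ConnectedComponent

namespace ClosedCurve

variable {m₁ m₂ : Connection n}

/-- The number of arcs of the curve that pass through the inner crosscap (each such arc is counted
at both of its ends). -/
noncomputable def innerCrossings (c : ClosedCurve m₁ m₂) : ℕ :=
  {i ∈ c.supp | m₁.Crosses i}.ncard / 2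

/-- The number of arcs of the curve that pass through the outer crosscap. -/
noncomputable def outerCrossings (c : ClosedCurve m₁ m₂) : ℕ :=
  {i ∈ c.supp | m₂.Crosses i}.ncard / 2

/-- The curve lifts to a closed curve in the infinite cyclic cover of the Klein bottle that consists
of two strips glued along both boundary lines: following the lifted arcs of `m₁` and `m₂`
alternately, one returns to the starting point. -/
def LiftsClosed (c : ClosedCurve m₁ m₂) : Prop :=
  ∀ p : StripPt, label n p ∈ c.supp → p ∈ Function.periodicPts (m₂.mate ∘ m₁.mate)

open Classical in
/-- The type of a curve. A simple closed curve on the Klein bottle that passes through both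
crosscaps an even number of times is trivial or separates the crosscaps; the infinite cyclic
cover is an open annulus, in which the trivial curve lifts to closed curves and the separating one,
which represents the square of a generator of the deck group, does not. -/
noncomputable def type (c : ClosedCurve m₁ m₂) : CurveType :=
  if Odd c.innerCrossings then
    if Odd c.outerCrossings then .w else .x
  else
    if Odd c.outerCrossings then .y else if c.LiftsClosed then .d else .z

end ClosedCurve

noncomputable instance [NeZero n] (m₁ m₂ : Connection n) : Fintype (ClosedCurve m₁ m₂) :=
  haveI : NeZero (2 * n) := ⟨mul_ne_zero two_ne_zero (NeZero.ne n)⟩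
  Fintype.ofFinite _

/-- The value of the bilinear form on two crossingless connections: the monomial in
`ℤ[d, w, x, y, z]` recording the closed curves that they form on the Klein bottle. -/
noncomputable def form [NeZero n] (m₁ m₂ : Connection n) : MvPolynomial CurveType ℤ :=
  ∏ c : ClosedCurve m₁ m₂, MvPolynomial.X c.type

/-- The Gram matrix of type `Mb`. -/
noncomputable def gramMatrix (n : ℕ) [NeZero n] :
    Matrix (Connection n) (Connection n) (MvPolynomial CurveType ℤ) :=
  Matrix.of fun m₁ m₂ => form m₁ m₂

open Classical in
/-- The Gram determinant of type `Mb`. -/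
noncomputable def gramDet (n : ℕ) [NeZero n] : MvPolynomial CurveType ℤ :=
  (gramMatrix n).det

end KleinGram

/-!
Cut the arc through the crosscap out of a connection, keeping the `n - 1` other arcs, none of which
crosses the crosscap. The two marked points set free can be joined again by an arc through the
crosscap or, in two ways, by an arc that avoids it. Glued to a fixed `m`, the three resulting
connections form the same curves except for the one through the free points. If that curve passes
through the outer crosscap an odd number of times, its type is `w` in the first case and `y` in
both other cases; otherwise it is `x` in the first case, and `d` and `z`, in some order, in the
other two. Hence `(d + z)` times the row of the first connection, minus `x` times the sum of the
rows of the other two, is divisible by `p = w (d + z) - 2 x y`.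

Let `N` be the number of these systems of `n - 1` arcs. The row operations give
`p ^ N ∣ (d + z) ^ N * det G`, and `p` and `d + z` are relatively prime. The systems correspond to
lattice paths whose period has `n - 1` steps up and `n + 1` steps down, the arcs running below the
graph of the path and the free points being the steps that reach a new minimum, so that
`N = (2 * n).choose (n - 1)`.
-/

namespace KleinGram

/-! ### Divisibility of determinants -/

section Determinant

open Matrix

variable {ι R : Type*} [Fintype ι] [DecidableEq ι] [CommRing R]

theorem pow_card_dvd_det_of_dvd_rows (G : Matrix ι ι R) (s : Finset ι) (p : R)
    (h : ∀ i ∈ s, ∀ j, p ∣ G i j) : p ^ s.card ∣ G.det := by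
  choose! Q hQ using h
  have hG : G = of fun i j => (if i ∈ s then p else 1) * (if i ∈ s then Q i j else G i j) := by
    ext i j
    by_cases hi : i ∈ s
    · simp [hi, ← hQ i hi j]
    · simp [hi]
  rw [hG, det_mul_column (fun i => if i ∈ s then p else 1)
    fun i j => if i ∈ s then Q i j else G i j]
  simp only [Finset.prod_ite_mem, Finset.univ_inter, Finset.prod_const]
  exact dvd_mul_right _ _

theorem pow_card_dvd_pow_card_mul_det (G : Matrix ι ι R) (s : Finset ι) (p v : R)
    (h : ∀ i ∈ s, ∃ L : ι → R, (∀ j ∈ s, L j = 0) ∧ ∀ j, p ∣ v * G i j - (L ᵥ* G) j) :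
    p ^ s.card ∣ v ^ s.card * G.det := by
  choose! L hLs hLG using h
  let T : Matrix ι ι R := of fun i => if i ∈ s then v • Pi.single i 1 - L i else Pi.single i 1
  have hT : T.det = v ^ s.card := by
    have hdiag : T.toSquareBlockProp (· ∈ s) = v • 1 := by
      ext ⟨i, hi⟩ ⟨j, hj⟩
      simp [T, toSquareBlockProp, hi, hLs i hi j hj, one_apply, Pi.single_apply, eq_comm]
    have hone : T.toSquareBlockProp (¬ · ∈ s) = 1 := by
      ext ⟨i, hi⟩ ⟨j, hj⟩
      simp [T, toSquareBlockProp, hi, one_apply, Pi.single_apply, eq_comm]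
    have htri : ∀ i, i ∉ s → ∀ j, j ∈ s → T i j = 0 := fun i hi j hj => by
      rw [show T i = Pi.single i 1 from if_neg hi]
      exact Pi.single_eq_of_ne (ne_of_mem_of_not_mem hj hi) 1
    simp [twoBlockTriangular_det T (· ∈ s) htri, hdiag, hone, Fintype.card_subtype]
  rw [← hT, ← det_mul]
  refine pow_card_dvd_det_of_dvd_rows _ s p fun i hi j => ?_
  have hrow : (T * G) i = v • G i - L i ᵥ* G := by
    rw [mul_apply_eq_vecMul, show T i = v • Pi.single i 1 - L i from if_pos hi, sub_vecMul,
      smul_vecMul, single_one_vecMul, row_def]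
  rw [hrow]
  exact hLG i hi j

end Determinant

section RelPrime

open MvPolynomial

theorem isRelPrime_of_irreducible_of_isUnit_map {M N F : Type*} [CommMonoid M] [CommMonoid N]
    [FunLike F M N] [MulHomClass F M N] (φ : F) {q f : M} (hq : Irreducible q)
    (hφq : ¬ IsUnit (φ q)) (hφf : IsUnit (φ f)) : IsRelPrime q f :=
  hq.isRelPrime_iff_not_dvd.2 fun h => hφq (isUnit_of_dvd_unit (map_dvd φ h) hφf)

theorem isRelPrime_factor_d_add_z : IsRelPrime
    (X .w * (X .d + X .z) - 2 * (X .x * X .y)) (X .d + X .z : MvPolynomial CurveType ℤ) := by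
  classical
  let φ : MvPolynomial CurveType ℤ →+* ℤ := eval (Pi.single CurveType.d 1)
  have hφ : IsUnit (φ (X .d + X .z)) := by simp [φ]
  have h2 : IsRelPrime (2 : MvPolynomial CurveType ℤ) (X .d + X .z) := by
    rw [show (2 : MvPolynomial CurveType ℤ) = C 2 from (map_ofNat C 2).symm]
    refine isRelPrime_of_irreducible_of_isUnit_map φ
      ((prime_C_iff _).2 Int.prime_two).irreducible ?_ hφ
    simp only [φ, eval_C]
    decide
  have hx : IsRelPrime (X .x : MvPolynomial CurveType ℤ) (X .d + X .z) :=
    isRelPrime_of_irreducible_of_isUnit_map φ X_prime.irreducible (by simp [φ]) hφ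
  have hy : IsRelPrime (X .y : MvPolynomial CurveType ℤ) (X .d + X .z) :=
    isRelPrime_of_irreducible_of_isUnit_map φ X_prime.irreducible (by simp [φ]) hφ
  intro r hr hrv
  refine h2.mul_left (hx.mul_left hy) ?_ hrv
  have := dvd_sub (hrv.mul_left (X .w)) hr
  rwa [sub_sub_cancel] at this

end RelPrime

/-! ### Arc systems off the crosscap and lattice paths -/

/-- A system of `n - 1` disjoint arcs off the crosscap, with two further marked points not joined by
any arc, seen on the universal cover `ℤ` of the boundary circle: `cup` exchanges the two ends of
each lifted arc and fixes the lifts of the free points, and `free` enumerates the latter. As the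
free points are to be joined through the crosscap, no arc separates them from it. -/
structure CupSystem (n : ℕ) where
  cup : ℤ → ℤ
  free : ℤ → ℤ
  cup_cup : ∀ i, cup (cup i) = i
  cup_add : ∀ i, cup (i + 2 * n) = cup i + 2 * n
  free_strictMono : StrictMono free
  free_add_two : ∀ i, free (i + 2) = free i + 2 * n
  cup_eq_self : ∀ i, cup i = i ↔ ∃ k, free k = i
  noncrossing : ∀ i j, ¬ (i < j ∧ j < cup i ∧ cup i < cup j)
  uncovered : ∀ i k, ¬ (i < free k ∧ free k < cup i)

/-- A lattice path with steps `±1` that loses two units in each period `2 * n`. -/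
structure LatticePath (n : ℕ) where
  height : ℤ → ℤ
  step : ∀ i, height (i + 1) = height i + 1 ∨ height (i + 1) = height i - 1
  drift : ∀ i, height (i + 2 * n) = height i - 2

namespace LatticePath

variable {n : ℕ} (h : LatticePath n)

theorem height_add_mul (i k : ℤ) : h.height (i + k * (2 * n)) = h.height i - 2 * k := by
  induction k with
  | zero => simp
  | succ k ih =>
    rw [show i + ((k : ℤ) + 1) * (2 * n) = i + k * (2 * n) + 2 * n by ring, h.drift, ih]; ring
  | pred k ih =>
    have := h.drift (i + (-(k : ℤ) - 1) * (2 * n))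
    rw [show i + (-(k : ℤ) - 1) * (2 * n) + 2 * n = i + -(k : ℤ) * (2 * n) by ring, ih] at this
    linarith

theorem exists_forall_le_lt_height [NeZero n] (v : ℤ) : ∃ N, ∀ t ≤ N, v < h.height t := by
  have hpos : (0 : ℤ) < 2 * n := mod_cast Nat.mul_pos two_pos (NeZero.pos n)
  obtain ⟨b, hb⟩ := ((Set.finite_Ico (0 : ℤ) (2 * n)).image h.height).bddBelow
  refine ⟨(b - v - |b - v| - 1) * (2 * n), fun t ht => ?_⟩
  have hr : b ≤ h.height (t % (2 * n)) :=
    hb ⟨_, ⟨Int.emod_nonneg t hpos.ne', Int.emod_lt_of_pos t hpos⟩, rfl⟩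
  have hq : t / (2 * n) ≤ b - v - |b - v| - 1 := Int.ediv_le_of_le_mul hpos ht
  rw [← Int.emod_add_ediv_mul t (2 * n), h.height_add_mul]
  linarith [neg_abs_le (b - v), le_abs_self (b - v)]

theorem exists_ge_height_le (v s : ℤ) : ∃ t, s ≤ t ∧ h.height t ≤ v := by
  have habs := abs_nonneg (h.height s - v)
  refine ⟨s + |h.height s - v| * (2 * n), le_add_of_nonneg_right (by positivity), ?_⟩
  rw [h.height_add_mul]
  linarith [le_abs_self (h.height s - v)]

theorem exists_first [NeZero n] (v : ℤ) :
    ∃ t, h.height (t + 1) = v ∧ ∀ s ≤ t, v < h.height s := by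
  obtain ⟨N, hN⟩ := h.exists_forall_le_lt_height v
  obtain ⟨t, _, ht⟩ := h.exists_ge_height_le v 0
  obtain ⟨m, hm, hmin⟩ := Int.exists_least_of_bdd (P := fun t => h.height t ≤ v)
    ⟨N, fun z hz => (not_le.1 fun hzN => (hN z hzN).not_ge hz).le⟩ ⟨t, ht⟩
  have hlt : ∀ s ≤ m - 1, v < h.height s := fun s hs =>
    not_le.1 fun hsv => by have := hmin s hsv; omega
  have hpred := hlt (m - 1) le_rfl
  have hstep := h.step (m - 1)
  rw [sub_add_cancel] at hstep
  exact ⟨m - 1, by rw [sub_add_cancel]; omega, hlt⟩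

/-- The steps `i < j` are the two ends of an arc below the graph of the path: step `i` goes up and
`j` is the step down that returns to the height before `i`. -/
def ArcBelow (i j : ℤ) : Prop :=
  i < j ∧ h.height i = h.height (j + 1) ∧ ∀ t, i < t → t ≤ j → h.height i < h.height t

/-- The steps `i` and `j`, in either order, are the two ends of an arc below the graph. -/
def Joined (i j : ℤ) : Prop := h.ArcBelow i j ∨ h.ArcBelow j i

/-- The step `i` reaches a new minimum of the path. -/
def IsRecord (i : ℤ) : Prop := ∀ t ≤ i, h.height (i + 1) < h.height t

variable {h}

theorem ArcBelow.height_succ_left {i j : ℤ} (b : h.ArcBelow i j) :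
    h.height (i + 1) = h.height i + 1 := by
  have := h.step i
  have := b.2.2 (i + 1) (by omega) b.1
  omega

theorem ArcBelow.height_succ_right {i j : ℤ} (b : h.ArcBelow i j) :
    h.height (j + 1) = h.height j - 1 := by
  have := h.step j
  have := b.2.2 j b.1 le_rfl
  have := b.2.1
  omega

theorem ArcBelow.right_unique {i j k : ℤ} (b : h.ArcBelow i j) (c : h.ArcBelow i k) : j = k := by
  have hle : ∀ {j k}, h.ArcBelow i j → h.ArcBelow i k → k ≤ j := fun {j k} b c => by
    by_contra! hjk
    have := c.2.2 (j + 1) (by have := b.1; omega) (by omega)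
    have := b.2.1
    omega
  exact le_antisymm (hle c b) (hle b c)

theorem ArcBelow.left_unique {i j k : ℤ} (b : h.ArcBelow i k) (c : h.ArcBelow j k) : i = j := by
  have hle : ∀ {i j}, h.ArcBelow i k → h.ArcBelow j k → j ≤ i := fun {i j} b c => by
    by_contra! hij
    have := b.2.2 j hij c.1.le
    have := b.2.1
    have := c.2.1
    omega
  exact le_antisymm (hle c b) (hle b c)

theorem ArcBelow.noncrossing {i j k l : ℤ} (b : h.ArcBelow i j) (c : h.ArcBelow k l) :
    ¬ (i < k ∧ k < j ∧ j < l) := by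
  rintro ⟨hik, hkj, hjl⟩
  have := b.2.2 k hik hkj.le
  have := c.2.2 (j + 1) (by omega) (by omega)
  have := b.2.1
  omega

theorem ArcBelow.add_period {i j : ℤ} (b : h.ArcBelow i j) :
    h.ArcBelow (i + 2 * n) (j + 2 * n) := by
  obtain ⟨hij, hret, hpos⟩ := b
  refine ⟨by omega, ?_, fun t ht ht' => ?_⟩
  · rw [add_right_comm j, h.drift, h.drift, hret]
  · have := hpos (t - 2 * n) (by omega) (by omega)
    have := h.drift (t - 2 * n)
    have := h.drift i
    rw [sub_add_cancel] at *
    omega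

theorem Joined.symm {i j : ℤ} (b : h.Joined i j) : h.Joined j i := Or.symm b

theorem Joined.add_period {i j : ℤ} (b : h.Joined i j) : h.Joined (i + 2 * n) (j + 2 * n) :=
  Or.imp ArcBelow.add_period ArcBelow.add_period b

theorem Joined.unique {i j k : ℤ} (b : h.Joined i j) (c : h.Joined i k) : j = k := by
  rcases b with b | b <;> rcases c with c | c
  · exact b.right_unique c
  · have := b.height_succ_left; have := c.height_succ_right; omega
  · have := b.height_succ_right; have := c.height_succ_left; omega
  · exact b.left_unique c

theorem IsRecord.not_joined {i j : ℤ} (hr : h.IsRecord i) : ¬ h.Joined i j := by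
  rintro (b | b)
  · have := b.height_succ_left; have := hr i le_rfl; omega
  · have := b.2.1; have := hr j b.1.le; omega

theorem IsRecord.not_covered {i j k : ℤ} (hr : h.IsRecord k) (b : h.ArcBelow i j) :
    ¬ (i < k ∧ k < j) := by
  rintro ⟨hik, hkj⟩
  have := hr i hik.le
  have := b.2.2 (k + 1) (by omega) hkj
  omega

theorem IsRecord.add_period {i : ℤ} (hr : h.IsRecord i) : h.IsRecord (i + 2 * n) := fun t ht => by
  have := hr (t - 2 * n) (by omega)
  have hdrift := h.drift (t - 2 * n)
  rw [sub_add_cancel] at hdrift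
  rw [add_right_comm, h.drift, hdrift]
  omega

variable (h)

theorem exists_arcBelow_of_up {i : ℤ} (hi : h.height (i + 1) = h.height i + 1) :
    ∃ j, h.ArcBelow i j := by
  obtain ⟨t, ht, ht'⟩ := h.exists_ge_height_le (h.height i) (i + 1)
  obtain ⟨m, ⟨hm, hm'⟩, hmin⟩ := Int.exists_least_of_bdd
    (P := fun t => i + 1 ≤ t ∧ h.height t ≤ h.height i) ⟨i + 1, fun z hz => hz.1⟩ ⟨t, ht, ht'⟩
  have hlt : ∀ s, i < s → s ≤ m - 1 → h.height i < h.height s := fun s hs hs' =>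
    not_le.1 fun hsi => by have := hmin s ⟨by omega, hsi⟩; omega
  have hne : i + 1 ≠ m := by rintro rfl; omega
  have hpred := hlt (m - 1) (by omega) le_rfl
  have hstep := h.step (m - 1)
  rw [sub_add_cancel] at hstep
  exact ⟨m - 1, by omega, by rw [sub_add_cancel]; omega, hlt⟩

theorem exists_arcBelow_of_down {i : ℤ} (hi : h.height (i + 1) = h.height i - 1)
    (hr : ¬ h.IsRecord i) : ∃ j, h.ArcBelow j i := by
  simp only [IsRecord, not_forall, not_lt] at hr
  obtain ⟨t, ht, ht'⟩ := hr
  obtain ⟨m, ⟨hm, hm'⟩, hmax⟩ := Int.exists_greatest_of_bdd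
    (P := fun t => t ≤ i ∧ h.height t ≤ h.height (i + 1)) ⟨i, fun z hz => hz.1⟩ ⟨t, ht, ht'⟩
  have hlt : ∀ s, m < s → s ≤ i → h.height (i + 1) < h.height s := fun s hs hs' =>
    not_le.1 fun hsi => by have := hmax s ⟨hs', hsi⟩; omega
  have hne : m ≠ i := by rintro rfl; omega
  have hsucc := hlt (m + 1) (by omega) (by omega)
  have hstep := h.step m
  have hret : h.height m = h.height (i + 1) := by omega
  exact ⟨m, by omega, hret, fun s hs hs' => hret ▸ hlt s hs hs'⟩

theorem exists_joined_or_isRecord (i : ℤ) : (∃ j, h.Joined i j) ∨ h.IsRecord i := by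
  rcases h.step i with hi | hi
  · exact Or.inl ((h.exists_arcBelow_of_up hi).imp fun _ => Or.inl)
  · exact or_iff_not_imp_right.2 fun hr => (h.exists_arcBelow_of_down hi hr).imp fun _ => Or.inr

open Classical in
/-- The other end of the arc that ends at the step `i`; the step itself if it is a record. -/
noncomputable def partner (i : ℤ) : ℤ := if hi : ∃ j, h.Joined i j then hi.choose else i

theorem joined_partner_or (i : ℤ) :
    h.Joined i (h.partner i) ∨ h.partner i = i ∧ h.IsRecord i := by
  by_cases hi : ∃ j, h.Joined i j
  · left; rw [partner, dif_pos hi]; exact hi.choose_spec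
  · right; exact ⟨dif_neg hi, (h.exists_joined_or_isRecord i).resolve_left hi⟩

variable {h}

theorem Joined.partner_eq {i j : ℤ} (b : h.Joined i j) : h.partner i = j := by
  rcases h.joined_partner_or i with c | ⟨_, hr⟩
  · exact c.unique b
  · exact absurd b hr.not_joined

theorem IsRecord.partner_eq {i : ℤ} (hr : h.IsRecord i) : h.partner i = i :=
  dif_neg fun ⟨_, b⟩ => hr.not_joined b

theorem arcBelow_of_lt_partner {i : ℤ} (hi : i < h.partner i) : h.ArcBelow i (h.partner i) := by
  rcases h.joined_partner_or i with (c | c) | ⟨e, _⟩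
  · exact c
  · exact absurd c.1 hi.not_gt
  · exact absurd e hi.ne'

theorem isRecord_of_partner_eq {i : ℤ} (hi : h.partner i = i) : h.IsRecord i := by
  rcases h.joined_partner_or i with (c | c) | ⟨_, hr⟩
  · exact absurd hi c.1.ne'
  · exact absurd hi c.1.ne
  · exact hr

variable (h)

theorem lt_partner_iff (i : ℤ) : i < h.partner i ↔ h.height (i + 1) = h.height i + 1 := by
  refine ⟨fun hi => (arcBelow_of_lt_partner hi).height_succ_left, fun hi => ?_⟩
  obtain ⟨j, b⟩ := h.exists_arcBelow_of_up hi
  rw [Joined.partner_eq (Or.inl b)]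
  exact b.1

theorem partner_partner (i : ℤ) : h.partner (h.partner i) = i := by
  rcases h.joined_partner_or i with c | ⟨e, _⟩
  · exact c.symm.partner_eq
  · rw [e, e]

theorem partner_add_period (i : ℤ) : h.partner (i + 2 * n) = h.partner i + 2 * n := by
  rcases h.joined_partner_or i with c | ⟨e, hr⟩
  · exact c.add_period.partner_eq
  · rw [e, hr.add_period.partner_eq]

variable [NeZero n]

/-- The step that reaches the height `v` for the first time. -/
noncomputable def firstAt (v : ℤ) : ℤ := (h.exists_first v).choose

theorem height_firstAt (v : ℤ) : h.height (h.firstAt v + 1) = v := (h.exists_first v).choose_spec.1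

theorem lt_height_of_le_firstAt {v s : ℤ} (hs : s ≤ h.firstAt v) : v < h.height s :=
  (h.exists_first v).choose_spec.2 s hs

theorem isRecord_firstAt (v : ℤ) : h.IsRecord (h.firstAt v) := fun t ht => by
  rw [h.height_firstAt]; exact h.lt_height_of_le_firstAt ht

theorem IsRecord.firstAt_height {h : LatticePath n} {t : ℤ} (hr : h.IsRecord t) :
    h.firstAt (h.height (t + 1)) = t := by
  have hv := h.height_firstAt (h.height (t + 1))
  rcases lt_trichotomy (h.firstAt (h.height (t + 1))) t with hlt | he | hlt
  · have := hr _ hlt; omega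
  · exact he
  · exact absurd (h.lt_height_of_le_firstAt hlt) (lt_irrefl _)

theorem firstAt_sub_two (v : ℤ) : h.firstAt (v - 2) = h.firstAt v + 2 * n := by
  have := (h.isRecord_firstAt v).add_period.firstAt_height
  rwa [add_right_comm, h.drift, h.height_firstAt] at this

theorem firstAt_strictAnti : StrictAnti h.firstAt := fun v w hvw => by
  by_contra! hle
  have hv := h.height_firstAt v
  rcases hle.lt_or_eq with hlt | he
  · exact hvw.not_gt (hv ▸ h.lt_height_of_le_firstAt hlt)
  · rw [he, h.height_firstAt] at hv
    exact hvw.ne' hv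

/-- The arcs below a lattice path, the free points being its records. -/
noncomputable def toCupSystem : CupSystem n where
  cup := h.partner
  free i := h.firstAt (-i)
  cup_cup := h.partner_partner
  cup_add := h.partner_add_period
  free_strictMono _ _ hij := h.firstAt_strictAnti (neg_lt_neg hij)
  free_add_two i := by rw [neg_add, ← sub_eq_add_neg, h.firstAt_sub_two]
  cup_eq_self i := by
    refine ⟨fun hi => ⟨-h.height (i + 1), ?_⟩, ?_⟩
    · rw [neg_neg, (isRecord_of_partner_eq hi).firstAt_height]
    · rintro ⟨k, rfl⟩
      exact (h.isRecord_firstAt _).partner_eq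
  noncrossing i j := fun ⟨hij, hj, hcup⟩ => (arcBelow_of_lt_partner (hij.trans hj)).noncrossing
    (arcBelow_of_lt_partner (hj.trans hcup)) ⟨hij, hj, hcup⟩
  uncovered i k hk :=
    (h.isRecord_firstAt _).not_covered (arcBelow_of_lt_partner (hk.1.trans hk.2)) hk

end LatticePath

section Walk

variable {M : Type*} [AddCommGroup M]

/-- The position at the integer time `i` of the walk on `M` that is at `0` at time `0` and makes the
step `f i` between the times `i` and `i + 1`. -/
noncomputable def walk (f : ℤ → M) (i : ℤ) : M :=
  ∑ j ∈ Finset.Ico 0 i, f j - ∑ j ∈ Finset.Ico i 0, f j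

theorem walk_zero (f : ℤ → M) : walk f 0 = 0 := sub_self _

theorem walk_of_nonneg (f : ℤ → M) {i : ℤ} (hi : 0 ≤ i) :
    walk f i = ∑ j ∈ Finset.Ico 0 i, f j := by
  rw [walk, Finset.Ico_eq_empty_of_le hi, Finset.sum_empty, sub_zero]

theorem walk_add_one (f : ℤ → M) (i : ℤ) : walk f (i + 1) = walk f i + f i := by
  rcases le_or_gt 0 i with hi | hi
  · rw [walk, walk, ← Finset.insert_Ico_right_eq_Ico_add_one hi,
      Finset.sum_insert Finset.right_notMem_Ico, Finset.Ico_eq_empty_of_le hi,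
      Finset.Ico_eq_empty_of_le (hi.trans (Int.le_add_one le_rfl))]
    abel
  · rw [walk, walk, ← Finset.insert_Ico_add_one_left_eq_Ico hi, Finset.sum_insert (by simp),
      Finset.Ico_eq_empty_of_le hi.le, Finset.Ico_eq_empty_of_le (Int.add_one_le_iff.2 hi)]
    abel

theorem walk_add_period {f : ℤ → M} {c : ℤ} (hf : f.Periodic c) (i : ℤ) :
    walk f (i + c) = walk f i + walk f c := by
  induction i with
  | zero => rw [zero_add, walk_zero, zero_add]
  | succ i ih => rw [add_right_comm, walk_add_one, walk_add_one, ih, hf]; abel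
  | pred i ih =>
    have h1 := walk_add_one f (-i - 1 + c)
    have h2 := walk_add_one f (-i - 1)
    rw [add_right_comm, sub_add_cancel, ih, hf] at h1
    rw [sub_add_cancel] at h2
    rw [h2, add_right_comm] at h1
    exact (add_right_cancel h1).symm

end Walk

variable {n : ℕ}

/-- The step `i` of the lattice path whose steps up within the period `[0, 2 * n)` are `S`. -/
def signStep (n : ℕ) (S : Finset ℤ) (i : ℤ) : ℤ := if i % (2 * n) ∈ S then 1 else -1

theorem signStep_periodic (S : Finset ℤ) : (signStep n S).Periodic (2 * n) := fun i => by
  rw [signStep, signStep, Int.add_emod_right]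

theorem sum_signStep {S : Finset ℤ} (hS : S ⊆ Finset.Ico 0 (2 * n : ℤ)) :
    ∑ i ∈ Finset.Ico 0 (2 * n : ℤ), signStep n S i = 2 * S.card - 2 * n := by
  have hstep : ∀ i ∈ Finset.Ico 0 (2 * n : ℤ), signStep n S i = 2 * (if i ∈ S then 1 else 0) - 1 :=
    fun i hi => by
      rw [Finset.mem_Ico] at hi
      rw [signStep, Int.emod_eq_of_lt hi.1 hi.2]
      split_ifs <;> norm_num
  rw [Finset.sum_congr rfl hstep, Finset.sum_sub_distrib, ← Finset.mul_sum, Finset.sum_ite_mem,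
    Finset.inter_eq_right.2 hS]
  simp

/-- The sets of steps up, within one period, of the lattice paths. -/
noncomputable def upSets (n : ℕ) : Finset (Finset ℤ) :=
  (Finset.Ico 0 (2 * n : ℤ)).powersetCard (n - 1)

theorem card_upSets (n : ℕ) : Fintype.card (upSets n) = (2 * n).choose (n - 1) := by
  rw [Fintype.card_coe, upSets, Finset.card_powersetCard, Int.card_Ico, sub_zero]
  rfl

section PathOfUpSet

variable [NeZero n]

/-- The lattice path with a given set of steps up. -/
noncomputable def upSetPath (S : upSets n) : LatticePath n where
  height := walk (signStep n S)
  step i := by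
    rw [walk_add_one, signStep]
    split_ifs
    · exact Or.inl rfl
    · exact Or.inr rfl
  drift i := by
    obtain ⟨hsub, hcard⟩ := Finset.mem_powersetCard.1 S.2
    rw [walk_add_period (signStep_periodic S.1), walk_of_nonneg (i := 2 * n) _ (by positivity),
      sum_signStep hsub, hcard, Nat.cast_pred (NeZero.pos n)]
    ring

theorem height_upSetPath_add_one_eq_iff (S : upSets n) (i : ℤ) :
    (upSetPath S).height (i + 1) = (upSetPath S).height i + 1 ↔ i % (2 * n) ∈ S.1 := by
  change walk _ (i + 1) = walk _ i + 1 ↔ _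
  rw [walk_add_one, add_right_inj, signStep]
  split_ifs with hi <;> simp [hi]

theorem cup_upSetPath_injective :
    Function.Injective fun S : upSets n => (upSetPath S).toCupSystem.cup := by
  intro S T hST
  have hmod : ∀ U : upSets n, ∀ i ∈ U.1, i % (2 * n) = i := fun U i hi => by
    have := Finset.mem_Ico.1 ((Finset.mem_powersetCard.1 U.2).1 hi)
    exact Int.emod_eq_of_lt this.1 this.2
  have hiff : ∀ i : ℤ, i % (2 * n) ∈ S.1 ↔ i % (2 * n) ∈ T.1 := fun i => by
    rw [← height_upSetPath_add_one_eq_iff, ← height_upSetPath_add_one_eq_iff,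
      ← LatticePath.lt_partner_iff, ← LatticePath.lt_partner_iff]
    exact iff_of_eq (congrArg (i < ·) (congrFun hST i))
  ext i
  exact ⟨fun hi => hmod S i hi ▸ (hiff i).1 ((hmod S i hi).symm ▸ hi),
    fun hi => hmod T i hi ▸ (hiff i).2 ((hmod T i hi).symm ▸ hi)⟩

end PathOfUpSet

/-! ### Deck transformations and the boundary of the strip -/

theorem semiconj_zpow {α β : Type*} {f : α → β} {σ : Equiv.Perm α} {τ : Equiv.Perm β}
    (h : Function.Semiconj f σ τ) (k : ℤ) : Function.Semiconj f ⇑(σ ^ k) ⇑(τ ^ k) := by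
  induction k with
  | zero => exact Function.Semiconj.id_right
  | succ k ih => rw [zpow_add_one, zpow_add_one]; exact ih.comp_right h
  | pred k ih =>
    rw [zpow_sub_one, zpow_sub_one]
    exact ih.comp_right (h.inverses_right σ.right_inv τ.left_inv)

/-- The generator of the group of deck transformations as a permutation. -/
def deckPerm (n : ℕ) : Equiv.Perm StripPt where
  toFun := deck n
  invFun p := (p.1 - n, !p.2)
  left_inv p := by simp [deck]
  right_inv p := by simp [deck]

theorem deckPerm_zpow_apply (k : ℤ) (p : StripPt) :
    (deckPerm n ^ k) p = (p.1 + k * n, if Even k then p.2 else !p.2) := by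
  induction k with
  | zero => simp
  | succ k ih =>
    rw [add_comm, zpow_one_add, Equiv.Perm.mul_apply, ih, add_comm (1 : ℤ)]
    refine Prod.ext ?_ ?_
    · simp only [deckPerm, Equiv.coe_fn_mk, deck]; ring
    · by_cases hk : Even k <;> simp [deckPerm, deck, hk, parity_simps]
  | pred k ih =>
    rw [sub_eq_neg_add, zpow_add, zpow_neg_one, Equiv.Perm.mul_apply, ih, ← sub_eq_neg_add]
    refine Prod.ext ?_ ?_
    · change p.1 + -(k : ℤ) * n - n = _
      ring
    · change (!(if Even (-(k : ℤ)) then p.2 else !p.2)) = _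
      by_cases hk : Even k <;> simp [hk, parity_simps]

theorem eq_zero_of_deckPerm_zpow_eq_self [NeZero n] {k : ℤ} {p : StripPt}
    (h : (deckPerm n ^ k) p = p) : k = 0 := by
  rw [deckPerm_zpow_apply] at h
  simpa [NeZero.ne n] using congrArg Prod.fst h

theorem label_deck (p : StripPt) : label n (deck n p) = label n p := by
  obtain ⟨a, s⟩ := p
  have h2n : (n : ZMod (2 * n)) + n = 0 := by
    rw [← two_mul]; exact_mod_cast ZMod.natCast_self (2 * n)
  cases s <;> simp [label, deck, add_assoc, h2n]

theorem label_zpow (k : ℤ) (p : StripPt) : label n ((deckPerm n ^ k) p) = label n p := by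
  simpa using semiconj_zpow (f := label n) (σ := deckPerm n) (τ := 1) label_deck k p

theorem label_eq_label_iff {p q : StripPt} :
    label n p = label n q ↔ ∃ k : ℤ, (deckPerm n ^ k) p = q := by
  refine ⟨fun h => ?_, ?_⟩
  · rw [label, label, ZMod.intCast_eq_intCast_iff_dvd_sub] at h
    obtain ⟨k, hk⟩ := h
    obtain ⟨a, s⟩ := p
    obtain ⟨b, t⟩ := q
    push_cast at hk
    simp only [deckPerm_zpow_apply, Prod.mk.injEq]
    cases s <;> cases t <;> simp only [Bool.false_eq_true, if_false, if_true] at hk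
    · exact ⟨2 * k, by linarith, by simp⟩
    · exact ⟨2 * k - 1, by linarith, by simp [parity_simps]⟩
    · exact ⟨2 * k + 1, by linarith, by simp [parity_simps]⟩
    · exact ⟨2 * k, by linarith, by simp⟩
  · rintro ⟨k, rfl⟩
    exact (label_zpow k p).symm

theorem label_surjective (n : ℕ) : Function.Surjective (label n) := fun i => by
  obtain ⟨k, hk⟩ := ZMod.intCast_surjective i
  exact ⟨(k, false), by simpa [label] using hk⟩

instance : IsStrictTotalOrder StripPt Before where
  irrefl := by
    rintro ⟨a, _ | _⟩ <;> simp [Before]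
  trans := by
    rintro ⟨a, _ | _⟩ ⟨b, _ | _⟩ ⟨c, _ | _⟩ hab hbc <;> simp only [Before] at * <;> omega
  trichotomous := by
    rintro ⟨a, _ | _⟩ ⟨b, _ | _⟩ hab hba <;>
      simp only [Before, not_true, not_lt, Prod.mk.injEq, and_true] at * <;> omega

theorem label_one_eq_of_ne_of_ne {x y z : StripPt} (hx : label 1 x ≠ label 1 z)
    (hy : label 1 y ≠ label 1 z) : label 1 x = label 1 y := by
  have two_elements : ∀ a b c : ZMod (2 * 1), a ≠ c → b ≠ c → a = b := by decide
  exact two_elements _ _ _ hx hy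

/-- The map of the strip that is `f` on the line `t = 0` and commutes with the generators of the
deck groups of the bands with `2 * a` and with `2 * b` marked points. -/
def onBothLines (a b : ℕ) (f : ℤ → ℤ) : StripPt → StripPt
  | (i, false) => (f i, false)
  | (i, true) => (f (i - a) + b, true)

section OnBothLines

variable {a b : ℕ} {f : ℤ → ℤ}

@[simp] theorem onBothLines_snd (p : StripPt) : (onBothLines a b f p).2 = p.2 := by
  rcases p with ⟨i, _ | _⟩ <;> rfl

theorem onBothLines_deck (hf : ∀ i, f (i + 2 * a) = f i + 2 * b) (p : StripPt) :
    onBothLines a b f (deck a p) = deck b (onBothLines a b f p) := by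
  rcases p with ⟨i, _ | _⟩
  · simp [onBothLines, deck]
  · have := hf (i - a)
    rw [show i - a + 2 * (a : ℤ) = i + a by ring] at this
    simp only [deck, onBothLines, Bool.not_true, this]
    exact Prod.ext (by simp only; ring) rfl

theorem before_onBothLines_iff (hf : StrictMono f) (p q : StripPt) :
    Before (onBothLines a b f p) (onBothLines a b f q) ↔ Before p q := by
  rcases p with ⟨i, _ | _⟩ <;> rcases q with ⟨j, _ | _⟩ <;>
    simp [onBothLines, Before, hf.lt_iff_lt]

theorem onBothLines_injective (hf : Function.Injective f) :
    Function.Injective (onBothLines a b f) := by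
  rintro ⟨i, _ | _⟩ ⟨j, _ | _⟩ h <;> simp_all [onBothLines, hf.eq_iff]

theorem onBothLines_involutive (hf : Function.Involutive f) :
    Function.Involutive (onBothLines a a f) := by
  rintro ⟨i, _ | _⟩ <;> simp [onBothLines, hf _]

theorem mem_range_onBothLines_iff (p : StripPt) :
    p ∈ Set.range (onBothLines a b f) ↔ (if p.2 then p.1 - b else p.1) ∈ Set.range f := by
  rcases p with ⟨i, _ | _⟩
  · simp [onBothLines, Prod.exists]
  · simp only [onBothLines, Set.mem_range, Prod.exists, Bool.exists_bool, Prod.mk.injEq,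
      reduceCtorEq, and_false, and_true, false_or, if_true, eq_sub_iff_add_eq]
    exact (Equiv.subRight (a : ℤ)).exists_congr_left.trans (by simp)

end OnBothLines

namespace Connection

variable (m : Connection n)

theorem mate_involutive : Function.Involutive m.mate := m.mate_mate

theorem mate_zpow (k : ℤ) (p : StripPt) :
    m.mate ((deckPerm n ^ k) p) = (deckPerm n ^ k) (m.mate p) :=
  semiconj_zpow (f := m.mate) (σ := deckPerm n) (τ := deckPerm n) m.mate_deck k p

theorem crosses_label_iff (p : StripPt) : m.Crosses (label n p) ↔ (m.mate p).2 ≠ p.2 := by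
  refine ⟨?_, fun h => ⟨p, rfl, h⟩⟩
  rintro ⟨q, hq, hne⟩
  obtain ⟨k, rfl⟩ := label_eq_label_iff.1 hq
  rw [mate_zpow, deckPerm_zpow_apply, deckPerm_zpow_apply]
  dsimp only
  split_ifs
  · exact hne
  · exact fun h => hne (Bool.not_inj_iff.1 h)

theorem joins_label_iff (p : StripPt) (j : ZMod (2 * n)) :
    m.Joins (label n p) j ↔ label n (m.mate p) = j := by
  refine ⟨?_, fun h => ⟨p, rfl, h⟩⟩
  rintro ⟨q, hq, rfl⟩
  obtain ⟨k, rfl⟩ := label_eq_label_iff.1 hq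
  rw [m.mate_zpow, label_zpow]

theorem label_mate_ne [NeZero n] (p : StripPt) : label n (m.mate p) ≠ label n p := by
  intro h
  obtain ⟨k, hk⟩ := label_eq_label_iff.1 h
  have hmate : (deckPerm n ^ k) p = m.mate p := by
    rw [← hk, m.mate_zpow, m.mate_mate, hk]
  have hk₂ : (deckPerm n ^ (k + k)) (m.mate p) = m.mate p := by
    rw [zpow_add, Equiv.Perm.mul_apply, hk, hmate]
  have hzero : k = 0 := by linarith [eq_zero_of_deckPerm_zpow_eq_self hk₂]
  rw [hzero, zpow_zero, Equiv.Perm.one_apply] at hk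
  exact m.mate_ne p hk

theorem joins_comm {i j : ZMod (2 * n)} : m.Joins i j ↔ m.Joins j i := by
  constructor <;> rintro ⟨p, rfl, rfl⟩ <;> exact ⟨m.mate p, rfl, by rw [m.mate_mate]⟩

end Connection

/-! ### Joining the free points -/

namespace CupSystem

variable (C : CupSystem n)

/-- The arcs of the system on both lines of the strip. -/
def stripCup : StripPt → StripPt := onBothLines n n C.cup

/-- The lifts to the strip of the free points, as the lifts of two marked points. -/
def stripFree : StripPt → StripPt := onBothLines 1 n C.free

theorem stripCup_snd (p : StripPt) : (C.stripCup p).2 = p.2 := onBothLines_snd p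

theorem stripFree_snd (p : StripPt) : (C.stripFree p).2 = p.2 := onBothLines_snd p

theorem stripCup_involutive : Function.Involutive C.stripCup := onBothLines_involutive C.cup_cup

theorem stripCup_deck (p : StripPt) : C.stripCup (deck n p) = deck n (C.stripCup p) :=
  onBothLines_deck C.cup_add p

theorem stripFree_deck (p : StripPt) : C.stripFree (deck 1 p) = deck n (C.stripFree p) :=
  onBothLines_deck (fun i => by simpa using C.free_add_two i) p

theorem stripCup_zpow (k : ℤ) (p : StripPt) :
    C.stripCup ((deckPerm n ^ k) p) = (deckPerm n ^ k) (C.stripCup p) :=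
  semiconj_zpow (f := C.stripCup) (σ := deckPerm n) (τ := deckPerm n) C.stripCup_deck k p

theorem stripFree_zpow (k : ℤ) (p : StripPt) :
    C.stripFree ((deckPerm 1 ^ k) p) = (deckPerm n ^ k) (C.stripFree p) :=
  semiconj_zpow (f := C.stripFree) (σ := deckPerm 1) (τ := deckPerm n) C.stripFree_deck k p

theorem stripFree_injective : Function.Injective C.stripFree :=
  onBothLines_injective C.free_strictMono.injective

theorem before_stripFree_iff {p q : StripPt} :
    Before (C.stripFree p) (C.stripFree q) ↔ Before p q :=
  before_onBothLines_iff C.free_strictMono p q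

theorem stripCup_eq_self_iff {p : StripPt} : C.stripCup p = p ↔ ∃ x, C.stripFree x = p := by
  rw [← Set.mem_range, stripFree, mem_range_onBothLines_iff, Set.mem_range, ← C.cup_eq_self]
  rcases p with ⟨i, _ | _⟩ <;> simp [stripCup, onBothLines, eq_sub_iff_add_eq]

theorem stripCup_stripFree (x : StripPt) : C.stripCup (C.stripFree x) = C.stripFree x :=
  C.stripCup_eq_self_iff.2 ⟨x, rfl⟩

theorem stripCup_noncrossing (p q : StripPt) :
    ¬ (Before p q ∧ Before q (C.stripCup p) ∧ Before (C.stripCup p) (C.stripCup q)) := by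
  rintro ⟨hpq, hq, hcup⟩
  rcases p with ⟨i, _ | _⟩ <;> rcases q with ⟨j, _ | _⟩ <;>
    simp only [Before, stripCup, onBothLines] at hpq hq hcup
  · exact C.noncrossing i j ⟨hpq, hq, hcup⟩
  · refine C.noncrossing (C.cup (j - n)) (C.cup (i - n)) ?_
    simp only [C.cup_cup]
    omega

theorem stripFree_uncovered (p x : StripPt) :
    ¬ (Before p (C.stripFree x) ∧ Before (C.stripFree x) (C.stripCup p)) := by
  rintro ⟨hpx, hx⟩
  rcases p with ⟨i, _ | _⟩ <;> rcases x with ⟨j, _ | _⟩ <;>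
    simp only [Before, stripCup, stripFree, onBothLines] at hpx hx
  · exact C.uncovered i j ⟨hpx, hx⟩
  · refine C.uncovered (C.cup (i - n)) (j - (1 : ℕ)) ?_
    simp only [C.cup_cup]
    omega

theorem uncovered_of_stripCup_eq_self (p q : StripPt) (hq : C.stripCup q = q) :
    ¬ (Before p q ∧ Before q (C.stripCup p)) := by
  obtain ⟨x, rfl⟩ := C.stripCup_eq_self_iff.1 hq
  exact C.stripFree_uncovered p x

theorem exists_stripFree_or (p : StripPt) : (∃ x, C.stripFree x = p) ∨ C.stripCup p ≠ p :=
  or_iff_not_imp_right.2 fun h => C.stripCup_eq_self_iff.1 (not_ne_iff.1 h)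

theorem stripCup_stripCup_ne {p : StripPt} (h : C.stripCup p ≠ p) :
    C.stripCup (C.stripCup p) ≠ C.stripCup p := by
  rw [C.stripCup_involutive]; exact h.symm

/-- The mate function of `C.insert u`. -/
noncomputable def insertMate (u : Connection 1) : StripPt → StripPt :=
  Function.extend C.stripFree (C.stripFree ∘ u.mate) C.stripCup

theorem insertMate_stripFree (u : Connection 1) (x : StripPt) :
    C.insertMate u (C.stripFree x) = C.stripFree (u.mate x) :=
  C.stripFree_injective.extend_apply _ _ x

theorem insertMate_of_ne (u : Connection 1) {p : StripPt} (hp : C.stripCup p ≠ p) :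
    C.insertMate u p = C.stripCup p :=
  Function.extend_apply' _ _ _ (mt C.stripCup_eq_self_iff.2 hp)

/-- The connection consisting of the arcs of `C` and of one more arc that joins the free points
as in `u`. -/
noncomputable def insert (u : Connection 1) : Connection n where
  mate := C.insertMate u
  mate_mate p := by
    rcases C.exists_stripFree_or p with ⟨x, rfl⟩ | h
    · rw [insertMate_stripFree, insertMate_stripFree, u.mate_mate]
    · rw [C.insertMate_of_ne u h, C.insertMate_of_ne u (C.stripCup_stripCup_ne h),
        C.stripCup_involutive]
  mate_ne p := by
    rcases C.exists_stripFree_or p with ⟨x, rfl⟩ | h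
    · rw [insertMate_stripFree, C.stripFree_injective.ne_iff]; exact u.mate_ne x
    · rwa [C.insertMate_of_ne u h]
  mate_deck p := by
    rcases C.exists_stripFree_or p with ⟨x, rfl⟩ | h
    · rw [insertMate_stripFree, ← C.stripFree_deck, insertMate_stripFree, u.mate_deck,
        C.stripFree_deck]
    · have h' : C.stripCup (deck n p) ≠ deck n p := by
        rw [C.stripCup_deck]; exact (deckPerm n).injective.ne h
      rw [C.insertMate_of_ne u h, C.insertMate_of_ne u h', C.stripCup_deck]
  noncrossing p q := by
    rcases C.exists_stripFree_or p with ⟨x, rfl⟩ | hp <;>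
      rcases C.exists_stripFree_or q with ⟨y, rfl⟩ | hq
    · simp only [insertMate_stripFree, before_stripFree_iff]
      exact u.noncrossing x y
    · simp only [insertMate_stripFree, C.insertMate_of_ne u hq]
      exact fun h => C.stripFree_uncovered q _ h.2
    · simp only [insertMate_stripFree, C.insertMate_of_ne u hp]
      exact fun h => C.stripFree_uncovered p _ ⟨h.1, h.2.1⟩
    · simp only [C.insertMate_of_ne u hp, C.insertMate_of_ne u hq]
      exact C.stripCup_noncrossing p q

theorem insert_mate_stripFree (u : Connection 1) (x : StripPt) :
    (C.insert u).mate (C.stripFree x) = C.stripFree (u.mate x) := C.insertMate_stripFree u x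

theorem insert_mate_of_ne (u : Connection 1) {p : StripPt} (hp : C.stripCup p ≠ p) :
    (C.insert u).mate p = C.stripCup p := C.insertMate_of_ne u hp

theorem insert_mate_snd_ne_iff (u : Connection 1) (p : StripPt) :
    ((C.insert u).mate p).2 ≠ p.2 ↔ ∃ x, C.stripFree x = p ∧ (u.mate x).2 ≠ x.2 := by
  refine ⟨fun hp => ?_, ?_⟩
  · rcases C.exists_stripFree_or p with ⟨x, rfl⟩ | h
    · rw [insert_mate_stripFree, stripFree_snd, stripFree_snd] at hp
      exact ⟨x, rfl, hp⟩
    · rw [C.insert_mate_of_ne u h, stripCup_snd] at hp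
      exact absurd rfl hp
  · rintro ⟨x, rfl, hx⟩
    rwa [insert_mate_stripFree, stripFree_snd, stripFree_snd]

end CupSystem

/-- The arc of two marked points that crosses the crosscap. -/
def crossArc : Connection 1 where
  mate p := (p.1, !p.2)
  mate_mate p := by simp
  mate_ne p := by simp [Prod.ext_iff]
  mate_deck p := by simp [deck]
  noncrossing := by
    rintro ⟨i, _ | _⟩ ⟨j, _ | _⟩ ⟨hij, hj, hij'⟩ <;>
      simp only [Before, Bool.not_false, Bool.not_true] at hij hj hij'
    all_goals omega

theorem crossArc_mate_snd_ne (x : StripPt) : (crossArc.mate x).2 ≠ x.2 := Bool.not_ne_self x.2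

/-- The two arcs of two marked points that can be isotoped off the crosscap: on the line `t = 0`,
the lifts of `sideArc false` join `2 * k` and `2 * k + 1`, those of `sideArc true` join `2 * k` and
`2 * k - 1`. -/
def sideArc (b : Bool) : Connection 1 where
  mate p := (if Even p.1 ↔ p.2 = b then p.1 + 1 else p.1 - 1, p.2)
  mate_mate := by
    rintro ⟨i, s⟩
    by_cases he : Even i <;> cases s <;> cases b <;> simp [he, parity_simps]
  mate_ne := by
    rintro ⟨i, s⟩
    simp only [ne_eq, Prod.mk.injEq, and_true]
    split_ifs <;> omega
  mate_deck := by
    rintro ⟨i, s⟩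
    by_cases he : Even i <;> cases s <;> cases b <;> simp [he, deck, parity_simps]
  noncrossing := by
    rintro ⟨i, _ | _⟩ ⟨j, _ | _⟩ ⟨hij, hj, -⟩ <;> simp only [Before] at hij hj
    all_goals split_ifs at hj <;> omega

/-! ### Parity of noncrossing involutions -/

section Parity

variable {α : Type*} {r : α → α → Prop} [DecidableRel r] [IsStrictTotalOrder α r] {A : Finset α}

theorem card_filter_rel_eq_add {x y : α} (hx : x ∉ A) (hxy : r x y) :
    {z ∈ A | r z y}.card = {z ∈ A | r z x}.card + {z ∈ A | r x z ∧ r z y}.card := by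
  rw [← Finset.card_filter_add_card_filter_not (fun z => r z x), Finset.filter_filter,
    Finset.filter_filter]
  congr 2 <;> refine Finset.filter_congr fun z hz => ?_
  · exact and_iff_right_of_imp fun hzx => _root_.trans hzx hxy
  · rw [and_comm]
    refine and_congr_left fun _ => ⟨fun hzx => ?_, fun hxz => asymm hxz⟩
    exact (trichotomous_of r x z).resolve_right
      (not_or.2 ⟨fun h => hx (h ▸ hz), hzx⟩)

variable {g : α → α}

theorem even_card_iff_even_card_fixed [DecidableEq α] (hg : g.Involutive)
    (hA : ∀ x ∈ A, g x ∈ A) : Even A.card ↔ Even {x ∈ A | g x = x}.card := by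
  have hmoved : ∑ x ∈ A with g x ≠ x, (1 : ZMod 2) = 0 :=
    Finset.sum_involution (fun x _ => g x) (fun _ _ => CharTwo.add_self_eq_zero 1)
      (fun x hx _ => (Finset.mem_filter.1 hx).2)
      (fun x hx => Finset.mem_filter.2 ⟨hA x (Finset.mem_filter.1 hx).1,
        by rw [hg]; exact (Finset.mem_filter.1 hx).2.symm⟩)
      (fun x _ => hg x)
  rw [Finset.sum_const, nsmul_one, ZMod.natCast_eq_zero_iff_even] at hmoved
  rw [← Finset.card_filter_add_card_filter_not (s := A) (fun x => g x = x), Nat.even_add]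
  simp only [hmoved, iff_true]

theorem even_card_rel_apply_iff (hg : g.Involutive) (hA : ∀ x ∈ A, g x ∈ A)
    (noncrossing : ∀ x y, ¬ (r x y ∧ r y (g x) ∧ r (g x) (g y)))
    (uncovered : ∀ x y, g y = y → ¬ (r x y ∧ r y (g x))) {x : α} (hx : x ∉ A) :
    Even {z ∈ A | r z (g x)}.card ↔ Even {z ∈ A | r z x}.card := by
  classical
  wlog hlt : r x (g x) generalizing x
  · rcases trichotomous_of r x (g x) with h | h | h
    · exact absurd h hlt
    · rw [← h]
    · have := this (x := g x) (fun hgx => hx (hg x ▸ hA _ hgx)) (by rwa [hg])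
      rw [hg] at this
      exact this.symm
  have hclosed : ∀ z ∈ ({z ∈ A | r x z ∧ r z (g x)} : Finset α),
      g z ∈ ({z ∈ A | r x z ∧ r z (g x)} : Finset α) := by
    simp only [Finset.mem_filter]
    rintro z ⟨hz, hxz, hzx⟩
    refine ⟨hA z hz, ?_, ?_⟩
    · rcases trichotomous_of r x (g z) with h | h | h
      · exact h
      · rw [h, hg] at hzx; exact absurd hzx (irrefl z)
      · exact absurd ⟨h, by rwa [hg], by rwa [hg]⟩ (noncrossing (g z) x)
    · rcases trichotomous_of r (g z) (g x) with h | h | h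
      · exact h
      · exact absurd hxz (hg.injective h ▸ irrefl z)
      · exact absurd ⟨hxz, hzx, h⟩ (noncrossing x z)
  have heven : Even {z ∈ A | r x z ∧ r z (g x)}.card := by
    rw [even_card_iff_even_card_fixed hg hclosed, Finset.filter_false_of_mem]
    · exact Even.zero
    · exact fun z hz hgz => uncovered x z hgz (Finset.mem_filter.1 hz).2
  rw [card_filter_rel_eq_add hx hlt, Nat.even_add]
  simp only [heven, iff_true]

theorem even_card_rel_iff_even_card_fixed [DecidableEq α] (hg : g.Involutive)
    (hA : ∀ x ∈ A, g x ∈ A) (uncovered : ∀ x y, g y = y → ¬ (r x y ∧ r y (g x))) {x : α}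
    (hx : g x = x) :
    Even {z ∈ A | r z x}.card ↔ Even {z ∈ A | r z x ∧ g z = z}.card := by
  rw [even_card_iff_even_card_fixed hg, Finset.filter_filter]
  simp only [Finset.mem_filter]
  rintro z ⟨hz, hzx⟩
  refine ⟨hA z hz, ?_⟩
  rcases trichotomous_of r (g z) x with h | h | h
  · exact h
  · have hzx' : z = x := by rw [← hg z, h, hx]
    exact absurd hzx (hzx' ▸ irrefl z)
  · exact absurd ⟨hzx, h⟩ (uncovered z x hx)

end Parity

/-! ### Orbits of two involutions -/

section AlternatingOrbit

variable {α : Type*} (σ τ : Equiv.Perm α) (x : α)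

/-- The orbit of `x` under the group generated by two involutions `σ` and `τ`: the points reached
from `x` by applying `σ` and `τ` alternately. -/
def alternatingOrbit : Set α :=
  {y | ∃ i : ℤ, ((σ * τ) ^ i) x = y ∨ σ (((σ * τ) ^ i) x) = y}

theorem mem_alternatingOrbit_self : x ∈ alternatingOrbit σ τ x := ⟨0, Or.inl rfl⟩

variable {σ τ x}

theorem alternatingOrbit_subset {B : Set α} (hσ : ∀ y, σ y ∈ B ↔ y ∈ B)
    (hτ : ∀ y, τ y ∈ B ↔ y ∈ B) (hx : x ∈ B) : alternatingOrbit σ τ x ⊆ B := by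
  have hzpow (i : ℤ) : ((σ * τ) ^ i) x ∈ B := by
    have hmul : Function.Semiconj (· ∈ B) ⇑(σ * τ) ⇑(1 : Equiv.Perm Prop) := fun y =>
      propext ((hσ _).trans (hτ y))
    have := semiconj_zpow hmul i x
    rw [one_zpow] at this
    exact this.mpr hx
  rintro _ ⟨i, rfl | rfl⟩
  · exact hzpow i
  · exact (hσ _).2 (hzpow i)

theorem apply_left_mem_alternatingOrbit_iff (hσ : Function.Involutive σ) {y : α} :
    σ y ∈ alternatingOrbit σ τ x ↔ y ∈ alternatingOrbit σ τ x := by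
  have hmem : ∀ y ∈ alternatingOrbit σ τ x, σ y ∈ alternatingOrbit σ τ x := by
    rintro _ ⟨i, rfl | rfl⟩
    · exact ⟨i, Or.inr rfl⟩
    · exact ⟨i, Or.inl (hσ _).symm⟩
  exact ⟨fun h => hσ y ▸ hmem _ h, hmem y⟩

theorem apply_right_mem_alternatingOrbit_iff (hσ : Function.Involutive σ)
    (hτ : Function.Involutive τ) {y : α} :
    τ y ∈ alternatingOrbit σ τ x ↔ y ∈ alternatingOrbit σ τ x := by
  have hmem : ∀ y ∈ alternatingOrbit σ τ x, τ y ∈ alternatingOrbit σ τ x := by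
    rintro _ ⟨i, rfl | rfl⟩
    · refine ⟨1 + i, Or.inr ?_⟩
      rw [zpow_one_add, Equiv.Perm.mul_apply, Equiv.Perm.mul_apply, hσ]
    · refine ⟨i - 1, Or.inl ((σ * τ).injective ?_)⟩
      rw [← Equiv.Perm.mul_apply, mul_self_zpow, sub_add_cancel,
        Equiv.Perm.mul_apply, hτ, hσ]
  exact ⟨fun h => hτ y ▸ hmem _ h, hmem y⟩

theorem apply_zpow_mul_eq_zpow_neg (hσ : Function.Involutive σ) (hτ : Function.Involutive τ)
    (i : ℤ) (y : α) : σ (((σ * τ) ^ i) y) = ((σ * τ) ^ (-i)) (σ y) := by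
  have hinv : Function.Semiconj σ ⇑(σ * τ) ⇑(σ * τ)⁻¹ := fun y => by
    rw [Equiv.Perm.eq_inv_iff_eq, Equiv.Perm.mul_apply, Equiv.Perm.mul_apply, hσ, hτ]
  rw [zpow_neg, ← inv_zpow]
  exact semiconj_zpow hinv i y

variable {δ : Equiv.Perm α}

theorem sq_apply_eq_self_or_exists_zpow (hσ : Function.Involutive σ) (hτ : Function.Involutive τ)
    (hδσ : Commute δ σ) (hδτ : Commute δ τ) (hδ : δ x ∈ alternatingOrbit σ τ x) :
    (δ ^ 2) x = x ∨ ∃ i : ℤ, ((σ * τ) ^ i) x = δ x := by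
  obtain ⟨i, hi | hi⟩ := hδ
  · exact Or.inr ⟨i, hi⟩
  · left
    calc (δ ^ 2) x = (δ * (σ * (σ * τ) ^ i)) x := by
          rw [sq, Equiv.Perm.mul_apply, Equiv.Perm.mul_apply, ← hi, Equiv.Perm.mul_apply]
      _ = σ (((σ * τ) ^ i) (δ x)) := by
          rw [(hδσ.mul_right ((hδσ.mul_right hδτ).zpow_right i)).eq]
          rfl
      _ = x := by
          rw [apply_zpow_mul_eq_zpow_neg hσ hτ, ← hi, hσ, ← Equiv.Perm.mul_apply, ← zpow_add,
            neg_add_cancel, zpow_zero, Equiv.Perm.one_apply]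

theorem sq_apply_eq_self_of_mem_alternatingOrbit (hσ : Function.Involutive σ)
    (hτ : Function.Involutive τ) (hδσ : Commute δ σ) (hδτ : Commute δ τ) (hx : σ x = x)
    (hδ : δ x ∈ alternatingOrbit σ τ x) : (δ ^ 2) x = x := by
  rcases sq_apply_eq_self_or_exists_zpow hσ hτ hδσ hδτ hδ with h | ⟨i, hi⟩
  · exact h
  · have hneg : ((σ * τ) ^ (-i)) x = δ x :=
      calc ((σ * τ) ^ (-i)) x = σ (((σ * τ) ^ i) x) := by
            rw [apply_zpow_mul_eq_zpow_neg hσ hτ, hx]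
        _ = (σ * δ) x := by rw [hi, Equiv.Perm.mul_apply]
        _ = δ x := by rw [← hδσ.eq, Equiv.Perm.mul_apply, hx]
    calc (δ ^ 2) x = (δ * (σ * τ) ^ i) x := by
          rw [sq, Equiv.Perm.mul_apply, Equiv.Perm.mul_apply, hi]
      _ = ((σ * τ) ^ i) (((σ * τ) ^ (-i)) x) := by
          rw [((hδσ.mul_right hδτ).zpow_right i).eq, Equiv.Perm.mul_apply, hneg]
      _ = x := by
          rw [← Equiv.Perm.mul_apply, ← zpow_add, add_neg_cancel, zpow_zero,
            Equiv.Perm.one_apply]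

theorem pow_two_mul_apply_eq_self_of_mem_alternatingOrbit (hσ : Function.Involutive σ)
    (hτ : Function.Involutive τ) (hδσ : Commute δ σ) (hδτ : Commute δ τ) {N : ℕ}
    (hN : ((σ * τ) ^ N) x = x) (hδ : δ x ∈ alternatingOrbit σ τ x) : (δ ^ (2 * N)) x = x := by
  rcases sq_apply_eq_self_or_exists_zpow hσ hτ hδσ hδτ hδ with h | ⟨i, hi⟩
  · rw [pow_mul]
    exact Function.IsFixedPt.perm_pow h N
  · have hcomm : Commute δ⁻¹ ((σ * τ) ^ i) := ((hδσ.mul_right hδτ).zpow_right i).inv_left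
    have hfix : Function.IsFixedPt ⇑(δ⁻¹ * (σ * τ) ^ i) x := by
      rw [Function.IsFixedPt, Equiv.Perm.mul_apply, hi, Equiv.Perm.inv_eq_iff_eq]
    have hpow : (((σ * τ) ^ i) ^ N) x = x := by
      rw [← zpow_natCast, zpow_comm, zpow_natCast]
      exact Function.IsFixedPt.perm_zpow hN i
    have hδN : (δ ^ N) x = x := by
      have := hfix.perm_pow N
      rwa [hcomm.mul_pow, Function.IsFixedPt, Equiv.Perm.mul_apply, hpow, inv_pow,
        Equiv.Perm.inv_eq_iff_eq, eq_comm] at this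
    rw [mul_comm, pow_mul]
    exact Function.IsFixedPt.perm_pow hδN 2

end AlternatingOrbit

/-! ### The strand through the free points -/

/-- The arcs of a connection as a permutation. -/
def Connection.matePerm (m : Connection n) : Equiv.Perm StripPt := m.mate_involutive.toPerm

theorem Connection.commute_deckPerm_zpow_matePerm (m : Connection n) (k : ℤ) :
    Commute (deckPerm n ^ k) m.matePerm := Equiv.ext fun p => (m.mate_zpow k p).symm

namespace CupSystem

variable (C : CupSystem n) (m : Connection n)

/-- The arcs of an arc system as a permutation. -/
def cupPerm : Equiv.Perm StripPt := C.stripCup_involutive.toPerm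

theorem commute_deckPerm_zpow_cupPerm (k : ℤ) : Commute (deckPerm n ^ k) C.cupPerm :=
  Equiv.ext fun p => (C.stripCup_zpow k p).symm

/-- The lift of the first free point. -/
def base : StripPt := C.stripFree (0, false)

/-- The lift, starting at the first free point, of the arc formed by the arcs of `C` in the inner
and those of `m` in the outer Moebius band. -/
def strand : Set StripPt := alternatingOrbit C.cupPerm m.matePerm C.base

theorem base_mem_strand : C.base ∈ C.strand m := mem_alternatingOrbit_self _ _ _

theorem stripCup_mem_strand_iff {p : StripPt} : C.stripCup p ∈ C.strand m ↔ p ∈ C.strand m :=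
  apply_left_mem_alternatingOrbit_iff C.stripCup_involutive

theorem mate_mem_strand_iff {p : StripPt} : m.mate p ∈ C.strand m ↔ p ∈ C.strand m :=
  apply_right_mem_alternatingOrbit_iff C.stripCup_involutive m.mate_involutive

theorem strand_subset {B : Set StripPt} (hcup : ∀ p, C.stripCup p ∈ B ↔ p ∈ B)
    (hmate : ∀ p, m.mate p ∈ B ↔ p ∈ B) (hbase : C.base ∈ B) : C.strand m ⊆ B :=
  alternatingOrbit_subset hcup hmate hbase

theorem zpow_mem_of_mem_strand {B : Set StripPt} (hcup : ∀ p, C.stripCup p ∈ B ↔ p ∈ B)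
    (hmate : ∀ p, m.mate p ∈ B ↔ p ∈ B) {p q : StripPt} (hp : p ∈ C.strand m)
    (hq : q ∈ C.strand m) {k : ℤ} (hpB : (deckPerm n ^ k) p ∈ B) : (deckPerm n ^ k) q ∈ B := by
  have hsame : C.strand m ⊆ {x | (deckPerm n ^ k) x ∈ B ↔ (deckPerm n ^ k) C.base ∈ B} := by
    refine C.strand_subset m (fun x => ?_) (fun x => ?_) Iff.rfl
    · rw [Set.mem_ofPred_eq, ← C.stripCup_zpow, hcup, Set.mem_ofPred_eq]
    · rw [Set.mem_ofPred_eq, ← m.mate_zpow, hmate, Set.mem_ofPred_eq]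
  exact (hsame hq).2 ((hsame hp).1 hpB)

section Finiteness

variable [NeZero n]

theorem eq_zero_of_zpow_mem_strand {p : StripPt} {k : ℤ} (hp : p ∈ C.strand m)
    (hk : (deckPerm n ^ k) p ∈ C.strand m) : k = 0 := by
  have hbase : (deckPerm n ^ k) C.base ∈ C.strand m :=
    C.zpow_mem_of_mem_strand m (fun _ => C.stripCup_mem_strand_iff m)
      (fun _ => C.mate_mem_strand_iff m) hp (C.base_mem_strand m) hk
  have hsq : ((deckPerm n ^ k) ^ 2) C.base = C.base :=
    sq_apply_eq_self_of_mem_alternatingOrbit C.stripCup_involutive m.mate_involutive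
      (C.commute_deckPerm_zpow_cupPerm k) (m.commute_deckPerm_zpow_matePerm k)
      (show C.cupPerm C.base = C.base from C.stripCup_stripFree (0, false)) hbase
  rw [← zpow_natCast, ← zpow_mul] at hsq
  simpa using eq_zero_of_deckPerm_zpow_eq_self hsq

theorem label_injOn_strand : Set.InjOn (label n) (C.strand m) := by
  intro p hp q hq hpq
  obtain ⟨k, rfl⟩ := label_eq_label_iff.1 hpq
  simp [C.eq_zero_of_zpow_mem_strand m hp hq]

theorem strand_finite : (C.strand m).Finite :=
  have : NeZero (2 * n) := ⟨mul_ne_zero two_ne_zero (NeZero.ne n)⟩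
  Set.Finite.of_injOn (Set.mapsTo_univ _ _) (C.label_injOn_strand m) Set.finite_univ

/-- The finitely many lifts of marked points on the strand. -/
noncomputable def strandFinset : Finset StripPt := (C.strand_finite m).toFinset

@[simp] theorem mem_strandFinset {p : StripPt} : p ∈ C.strandFinset m ↔ p ∈ C.strand m :=
  (C.strand_finite m).mem_toFinset

theorem stripCup_mem_strandFinset {p : StripPt} (hp : p ∈ C.strandFinset m) :
    C.stripCup p ∈ C.strandFinset m := by
  rwa [mem_strandFinset, stripCup_mem_strand_iff, ← mem_strandFinset]

theorem mate_mem_strandFinset {p : StripPt} (hp : p ∈ C.strandFinset m) :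
    m.mate p ∈ C.strandFinset m := by
  rwa [mem_strandFinset, mate_mem_strand_iff, ← mem_strandFinset]

end Finiteness

/-! ### The far end of the strand -/

section StrandEnd

variable [NeZero n]

theorem eq_of_label_eq_of_stripFree_mem_strand {x y : StripPt} (hx : C.stripFree x ∈ C.strand m)
    (hy : C.stripFree y ∈ C.strand m) (hxy : label 1 x = label 1 y) : x = y := by
  obtain ⟨k, rfl⟩ := label_eq_label_iff.1 hxy
  rw [C.stripFree_zpow] at hy
  simp [C.eq_zero_of_zpow_mem_strand m hx hy]

theorem exists_strandEnd : ∃ q, q ≠ (0, false) ∧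
    ∀ x, C.stripFree x ∈ C.strand m ↔ x = (0, false) ∨ x = q := by
  classical
  have heven : Even {p ∈ C.strandFinset m | C.stripCup p = p}.card := by
    rw [← even_card_iff_even_card_fixed C.stripCup_involutive
        fun _ => C.stripCup_mem_strandFinset m,
      even_card_iff_even_card_fixed m.mate_involutive fun _ => C.mate_mem_strandFinset m,
      Finset.filter_false_of_mem fun p _ => m.mate_ne p]
    exact Even.zero
  have hbase : C.base ∈ {p ∈ C.strandFinset m | C.stripCup p = p} :=
    Finset.mem_filter.2 ⟨(C.mem_strandFinset m).2 (C.base_mem_strand m), C.stripCup_stripFree _⟩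
  have hcard : 1 < {p ∈ C.strandFinset m | C.stripCup p = p}.card :=
    lt_of_le_of_ne (Finset.card_pos.2 ⟨_, hbase⟩) fun h => Nat.not_even_one (h ▸ heven)
  obtain ⟨p, hp, hne⟩ := Finset.exists_mem_ne hcard C.base
  obtain ⟨hp, hfix⟩ := Finset.mem_filter.1 hp
  obtain ⟨q, rfl⟩ := C.stripCup_eq_self_iff.1 hfix
  rw [mem_strandFinset] at hp
  have hq : q ≠ (0, false) := fun h => hne (congrArg C.stripFree h)
  refine ⟨q, hq, fun x => ⟨fun hx => ?_, ?_⟩⟩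
  · have hqL : label 1 q ≠ label 1 (0, false) := fun h =>
      hq (C.eq_of_label_eq_of_stripFree_mem_strand m hp (C.base_mem_strand m) h)
    by_cases h : label 1 x = label 1 (0, false)
    · exact Or.inl (C.eq_of_label_eq_of_stripFree_mem_strand m hx (C.base_mem_strand m) h)
    · exact Or.inr (C.eq_of_label_eq_of_stripFree_mem_strand m hx hp
        (label_one_eq_of_ne_of_ne h hqL))
  · rintro (rfl | rfl)
    exacts [C.base_mem_strand m, hp]

/-- The free point at which the strand that starts at the free point `(0, false)` ends. -/
noncomputable def strandEnd : StripPt := (C.exists_strandEnd m).choose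

theorem strandEnd_ne : C.strandEnd m ≠ (0, false) := (C.exists_strandEnd m).choose_spec.1

theorem stripFree_mem_strand_iff {x : StripPt} :
    C.stripFree x ∈ C.strand m ↔ x = (0, false) ∨ x = C.strandEnd m :=
  (C.exists_strandEnd m).choose_spec.2 x

theorem stripFree_strandEnd_mem_strand : C.stripFree (C.strandEnd m) ∈ C.strand m :=
  (C.stripFree_mem_strand_iff m).2 (Or.inr rfl)

theorem label_strandEnd_ne : label 1 (C.strandEnd m) ≠ label 1 (0, false) := fun h =>
  C.strandEnd_ne m (C.eq_of_label_eq_of_stripFree_mem_strand m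
    (C.stripFree_strandEnd_mem_strand m) (C.base_mem_strand m) h)

theorem base_ne_stripFree_strandEnd : C.base ≠ C.stripFree (C.strandEnd m) :=
  C.stripFree_injective.ne (C.strandEnd_ne m).symm

theorem even_card_filter_fixed_iff (P : StripPt → Prop) [DecidablePred P] :
    Even {p ∈ C.strandFinset m | P p ∧ C.stripCup p = p}.card ↔
      (P C.base ↔ P (C.stripFree (C.strandEnd m))) := by
  have hends : {p ∈ C.strandFinset m | P p ∧ C.stripCup p = p} =
      {p ∈ ({C.base, C.stripFree (C.strandEnd m)} : Finset StripPt) | P p} := by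
    ext p
    simp only [Finset.mem_filter, mem_strandFinset, Finset.mem_insert, Finset.mem_singleton,
      C.stripCup_eq_self_iff]
    constructor
    · rintro ⟨hp, hP, x, rfl⟩
      exact ⟨((C.stripFree_mem_strand_iff m).1 hp).imp (congrArg _) (congrArg _), hP⟩
    · rintro ⟨rfl | rfl, hP⟩
      · exact ⟨C.base_mem_strand m, hP, _, rfl⟩
      · exact ⟨C.stripFree_strandEnd_mem_strand m, hP, _, rfl⟩
  rw [hends, Finset.filter_insert, Finset.filter_singleton]
  split_ifs with h₁ h₂ h₂ <;> simp [h₁, h₂, C.base_ne_stripFree_strandEnd m]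

open Classical in
theorem even_card_before_zpow_iff {p q : StripPt} (hp : p ∈ C.strand m) (hq : q ∈ C.strand m)
    {k : ℤ} (hk : k ≠ 0) :
    Even {z ∈ C.strandFinset m | Before z ((deckPerm n ^ k) p)}.card ↔
      Even {z ∈ C.strandFinset m | Before z ((deckPerm n ^ k) q)}.card := by
  have hnot {x : StripPt} (hx : x ∈ C.strand m) : (deckPerm n ^ k) x ∉ C.strand m :=
    fun h => hk (C.eq_zero_of_zpow_mem_strand m hx h)
  refine (C.zpow_mem_of_mem_strand m (B := {x | x ∉ C.strand m ∧
    (Even {z ∈ C.strandFinset m | Before z ((deckPerm n ^ k) p)}.card ↔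
      Even {z ∈ C.strandFinset m | Before z x}.card)})
    (fun x => ?_) (fun x => ?_) hp hq ⟨hnot hp, Iff.rfl⟩).2
  · simp only [Set.mem_ofPred_eq, stripCup_mem_strand_iff]
    refine and_congr_right fun hx => iff_congr Iff.rfl ?_
    exact even_card_rel_apply_iff C.stripCup_involutive
      (fun _ => C.stripCup_mem_strandFinset m) C.stripCup_noncrossing
      C.uncovered_of_stripCup_eq_self (by simpa)
  · simp only [Set.mem_ofPred_eq, mate_mem_strand_iff]
    refine and_congr_right fun hx => iff_congr Iff.rfl ?_
    exact even_card_rel_apply_iff m.mate_involutive (fun _ => C.mate_mem_strandFinset m)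
      m.noncrossing (fun _ z hz => absurd hz (m.mate_ne z)) (by simpa)

/-- The strand is disjoint from its translate by `deckPerm n ^ 2`, so each of its two ends lies on
the same side of the translated strand. -/
theorem strandEnd_fst_of_snd_eq_false (h : (C.strandEnd m).2 = false) :
    C.strandEnd m = (1, false) ∨ C.strandEnd m = (-1, false) := by
  classical
  have hpar := C.even_card_before_zpow_iff m (C.base_mem_strand m)
    (C.stripFree_strandEnd_mem_strand m) two_ne_zero
  simp only [base, ← C.stripFree_zpow,
    even_card_rel_iff_even_card_fixed C.stripCup_involutive
      (fun _ => C.stripCup_mem_strandFinset m) C.uncovered_of_stripCup_eq_self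
      (C.stripCup_stripFree _),
    even_card_filter_fixed_iff, before_stripFree_iff] at hpar
  have hne := C.strandEnd_ne m
  obtain ⟨⟨t, s⟩, hend⟩ : ∃ q, C.strandEnd m = q := ⟨_, rfl⟩
  rw [hend] at hpar hne h ⊢
  obtain rfl : s = false := h
  simp only [deckPerm_zpow_apply, even_two, if_true, Before, Prod.mk.injEq, and_true, ne_eq]
    at hpar hne ⊢
  omega

end StrandEnd

end CupSystem

/-! ### Crossings of the strand -/

namespace CupSystem

variable [NeZero n] (C : CupSystem n) (m : Connection n)

theorem ncard_crosses_label_strand (m' : Connection n) :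
    {i ∈ label n '' C.strand m | m'.Crosses i}.ncard =
      {p ∈ C.strandFinset m | (m'.mate p).2 ≠ p.2}.card := by
  set A : Finset StripPt := {p ∈ C.strandFinset m | (m'.mate p).2 ≠ p.2} with hA
  have mem_A (p : StripPt) : p ∈ A ↔ p ∈ C.strand m ∧ (m'.mate p).2 ≠ p.2 := by
    rw [hA, Finset.mem_filter, mem_strandFinset]
  have himage : {i ∈ label n '' C.strand m | m'.Crosses i} = label n '' A := by
    ext i
    constructor
    · rintro ⟨⟨p, hp, rfl⟩, hcross⟩
      exact ⟨p, (mem_A p).2 ⟨hp, (m'.crosses_label_iff p).1 hcross⟩, rfl⟩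
    · rintro ⟨p, hp, rfl⟩
      exact ⟨⟨p, ((mem_A p).1 hp).1, rfl⟩, (m'.crosses_label_iff p).2 ((mem_A p).1 hp).2⟩
  have hinj : Set.InjOn (label n) A :=
    (C.label_injOn_strand m).mono fun p hp => ((mem_A p).1 hp).1
  rw [himage, hinj.ncard_image, Set.ncard_coe_finset]

theorem ncard_crosses_insert_sideArc (b : Bool) :
    {i ∈ label n '' C.strand m | (C.insert (sideArc b)).Crosses i}.ncard = 0 := by
  rw [ncard_crosses_label_strand, Finset.card_eq_zero, Finset.filter_eq_empty_iff]
  rintro p - hp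
  obtain ⟨x, -, hx⟩ := (C.insert_mate_snd_ne_iff _ p).1 hp
  exact hx rfl

theorem ncard_crosses_insert_crossArc :
    {i ∈ label n '' C.strand m | (C.insert crossArc).Crosses i}.ncard = 2 := by
  have hends : {p ∈ C.strandFinset m | ((C.insert crossArc).mate p).2 ≠ p.2} =
      {C.base, C.stripFree (C.strandEnd m)} := by
    ext p
    simp only [Finset.mem_filter, mem_strandFinset, insert_mate_snd_ne_iff, Finset.mem_insert,
      Finset.mem_singleton]
    constructor
    · rintro ⟨hp, x, rfl, -⟩
      exact ((C.stripFree_mem_strand_iff m).1 hp).imp (congrArg _) (congrArg _)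
    · rintro (rfl | rfl)
      · exact ⟨C.base_mem_strand m, _, rfl, crossArc_mate_snd_ne _⟩
      · exact ⟨C.stripFree_strandEnd_mem_strand m, _, rfl, crossArc_mate_snd_ne _⟩
  rw [ncard_crosses_label_strand, hends, Finset.card_pair (C.base_ne_stripFree_strandEnd m)]

theorem card_filter_crosses :
    {p ∈ C.strandFinset m | (m.mate p).2 ≠ p.2}.card =
      2 * {p ∈ C.strandFinset m | p.2 ∧ (m.mate p).2 ≠ p.2}.card := by
  have hswap : {p ∈ C.strandFinset m | ¬ p.2 ∧ (m.mate p).2 ≠ p.2}.card =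
      {p ∈ C.strandFinset m | p.2 ∧ (m.mate p).2 ≠ p.2}.card :=
    Finset.card_bij' (fun p _ => m.mate p) (fun p _ => m.mate p)
      (by simp +contextual [mate_mem_strand_iff, m.mate_mate])
      (by simp +contextual [mate_mem_strand_iff, m.mate_mate])
      (fun p _ => m.mate_mate p) (fun p _ => m.mate_mate p)
  rw [← Finset.card_filter_add_card_filter_not (fun p => p.2 = true), Finset.filter_filter,
    Finset.filter_filter, two_mul]
  simp only [and_comm] at hswap ⊢
  rw [hswap]

theorem even_card_top_crosses_iff :
    Even {p ∈ C.strandFinset m | p.2 ∧ (m.mate p).2 ≠ p.2}.card ↔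
      Even {p ∈ C.strandFinset m | p.2}.card := by
  have hflat : Even {p ∈ C.strandFinset m | p.2 ∧ (m.mate p).2 = p.2}.card := by
    rw [even_card_iff_even_card_fixed m.mate_involutive
        (by simp +contextual [mate_mem_strand_iff, m.mate_mate]),
      Finset.filter_false_of_mem fun p _ => m.mate_ne p]
    exact Even.zero
  rw [← Finset.card_filter_add_card_filter_not (s := {p ∈ C.strandFinset m | p.2})
    (fun p => (m.mate p).2 = p.2), Finset.filter_filter, Finset.filter_filter, Nat.even_add]
  simp only [hflat, true_iff, ne_eq]

theorem odd_outer_crossings_iff :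
    Odd ({i ∈ label n '' C.strand m | m.Crosses i}.ncard / 2) ↔ (C.strandEnd m).2 = true := by
  have hends := C.even_card_filter_fixed_iff m (fun p => p.2 = true)
  rw [base, stripFree_snd, stripFree_snd, ← Finset.filter_filter,
    ← even_card_iff_even_card_fixed C.stripCup_involutive
      (by simp +contextual [stripCup_mem_strand_iff, stripCup_snd])] at hends
  rw [ncard_crosses_label_strand, card_filter_crosses, Nat.mul_div_cancel_left _ two_pos,
    ← Nat.not_even_iff_odd, even_card_top_crosses_iff]
  rw [hends]
  simp only [Bool.false_eq_true, false_iff, not_not]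

end CupSystem

/-! ### Types of closed curves -/

section Restrict

variable {α : Type*} {f g : α → α} {S : Set α}

theorem mem_periodicPts_restrict_iff (hf : Set.MapsTo f S S) {x : α} (hx : x ∈ S) :
    ⟨x, hx⟩ ∈ Function.periodicPts (hf.restrict f S S) ↔ x ∈ Function.periodicPts f := by
  refine exists_congr fun k => and_congr_right fun _ => ?_
  rw [Function.IsPeriodicPt, Function.IsFixedPt, hf.iterate_restrict, Subtype.ext_iff]
  rfl

theorem mem_periodicPts_of_finite (hS : S.Finite) (hf : Set.MapsTo f S S)
    (hinj : Function.Injective f) {x : α} (hx : x ∈ S) : x ∈ Function.periodicPts f :=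
  have := hS.to_subtype
  (mem_periodicPts_restrict_iff hf hx).1
    (Function.Injective.mem_periodicPts (hf.restrict_inj.2 hinj.injOn) _)

theorem mem_periodicPts_congr (hf : Set.MapsTo f S S) (hfg : Set.EqOn f g S) {x : α}
    (hx : x ∈ S) : x ∈ Function.periodicPts f ↔ x ∈ Function.periodicPts g := by
  have hg : Set.MapsTo g S S := hf.congr hfg
  have hrestrict : hf.restrict f S S = hg.restrict g S S :=
    funext fun y => Subtype.ext (hfg y.2)
  rw [← mem_periodicPts_restrict_iff hf hx, ← mem_periodicPts_restrict_iff hg hx, hrestrict]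

end Restrict

/-- The lifted arcs that start at the marked points in `S` form closed curves; see
`ClosedCurve.LiftsClosed`. -/
def LiftsClosedOn (m₁ m₂ : Connection n) (S : Set (ZMod (2 * n))) : Prop :=
  ∀ p : StripPt, label n p ∈ S → p ∈ Function.periodicPts (m₂.mate ∘ m₁.mate)

open Classical in
/-- The type of the closed curve through the marked points in `S`. Unlike `ClosedCurve.type`, it
does not refer to `glueGraph m₁ m₂`, so it can be compared for different connections. -/
noncomputable def typeOn (m₁ m₂ : Connection n) (S : Set (ZMod (2 * n))) : CurveType :=
  if Odd ({i ∈ S | m₁.Crosses i}.ncard / 2) then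
    if Odd ({i ∈ S | m₂.Crosses i}.ncard / 2) then .w else .x
  else
    if Odd ({i ∈ S | m₂.Crosses i}.ncard / 2) then .y
    else if LiftsClosedOn m₁ m₂ S then .d else .z

theorem form_eq_prod [NeZero n] {m₁ m₂ : Connection n} {G : SimpleGraph (ZMod (2 * n))}
    [Fintype G.ConnectedComponent] (hG : glueGraph m₁ m₂ = G) :
    form m₁ m₂ = ∏ c : G.ConnectedComponent, MvPolynomial.X (typeOn m₁ m₂ c.supp) := by
  subst hG
  exact Finset.prod_congr (Finset.ext fun _ => by simp only [Finset.mem_univ]) fun _ _ => rfl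

theorem typeOn_congr_left {m₁ m₁' m₂ : Connection n} {S : Set (ZMod (2 * n))}
    (hmate : ∀ p, label n p ∈ S → m₁.mate p = m₁'.mate p)
    (hmaps : Set.MapsTo (m₂.mate ∘ m₁.mate) (label n ⁻¹' S) (label n ⁻¹' S)) :
    typeOn m₁ m₂ S = typeOn m₁' m₂ S := by
  have hcrosses : {i ∈ S | m₁.Crosses i} = {i ∈ S | m₁'.Crosses i} := by
    ext i
    obtain ⟨p, rfl⟩ := label_surjective n i
    simp only [Set.mem_ofPred_eq, and_congr_right_iff, Connection.crosses_label_iff]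
    exact fun hp => by rw [hmate p hp]
  have hlifts : LiftsClosedOn m₁ m₂ S = LiftsClosedOn m₁' m₂ S :=
    propext <| forall₂_congr fun p hp =>
      mem_periodicPts_congr hmaps (fun x hx => congrArg m₂.mate (hmate x hx)) hp
  rw [typeOn, typeOn, hcrosses, hlifts]

theorem glueGraph_adj {m₁ m₂ : Connection n} {i j : ZMod (2 * n)} :
    (glueGraph m₁ m₂).Adj i j ↔ i ≠ j ∧ (m₁.Joins i j ∨ m₂.Joins i j) := by
  rw [glueGraph, SimpleGraph.fromRel_adj, m₁.joins_comm (i := j), m₂.joins_comm (i := j), or_self]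

namespace ClosedCurve

variable {m₁ m₂ : Connection n} (c : ClosedCurve m₁ m₂)

theorem label_left_mate_mem_supp_iff {p : StripPt} :
    label n (m₁.mate p) ∈ c.supp ↔ label n p ∈ c.supp := by
  by_cases h : label n p = label n (m₁.mate p)
  · rw [h]
  · exact (c.mem_supp_congr_adj (glueGraph_adj.2 ⟨h, Or.inl ⟨p, rfl, rfl⟩⟩)).symm

theorem label_right_mate_mem_supp_iff {p : StripPt} :
    label n (m₂.mate p) ∈ c.supp ↔ label n p ∈ c.supp := by
  by_cases h : label n p = label n (m₂.mate p)
  · rw [h]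
  · exact (c.mem_supp_congr_adj (glueGraph_adj.2 ⟨h, Or.inr ⟨p, rfl, rfl⟩⟩)).symm

theorem supp_subset {S : Set (ZMod (2 * n))}
    (h₁ : ∀ p, label n p ∈ S → label n (m₁.mate p) ∈ S)
    (h₂ : ∀ p, label n p ∈ S → label n (m₂.mate p) ∈ S) {i : ZMod (2 * n)} (hi : i ∈ c.supp)
    (hiS : i ∈ S) : c.supp ⊆ S := by
  intro j hj
  by_contra hjS
  obtain ⟨path⟩ := c.reachable_of_mem_supp hi hj
  obtain ⟨e, -, hfst, hsnd⟩ := path.exists_boundary_dart S hiS hjS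
  obtain ⟨p, hp⟩ := label_surjective n e.fst
  rw [← hp] at hfst
  rcases (glueGraph_adj.1 e.adj).2 with h | h <;> rw [← hp, Connection.joins_label_iff] at h
  · exact hsnd (h ▸ h₁ p hfst)
  · exact hsnd (h ▸ h₂ p hfst)

end ClosedCurve

/-! ### The curve through the inserted arc -/

namespace CupSystem

variable (C : CupSystem n) (m : Connection n)

theorem label_stripFree_eq {x y : StripPt} (h : label 1 x = label 1 y) :
    label n (C.stripFree x) = label n (C.stripFree y) := by
  obtain ⟨k, rfl⟩ := label_eq_label_iff.1 h
  rw [C.stripFree_zpow, label_zpow]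

theorem joins_insert_iff (u v : Connection 1) {i j : ZMod (2 * n)} :
    (C.insert u).Joins i j ↔ (C.insert v).Joins i j := by
  obtain ⟨p, rfl⟩ := label_surjective n i
  rw [Connection.joins_label_iff, Connection.joins_label_iff]
  rcases C.exists_stripFree_or p with ⟨x, rfl⟩ | h
  · rw [insert_mate_stripFree, insert_mate_stripFree, C.label_stripFree_eq
      (label_one_eq_of_ne_of_ne (u.label_mate_ne x) (v.label_mate_ne x))]
  · rw [C.insert_mate_of_ne u h, C.insert_mate_of_ne v h]

theorem glueGraph_insert (u v : Connection 1) :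
    glueGraph (C.insert u) m = glueGraph (C.insert v) m := by
  ext i j
  rw [glueGraph_adj, glueGraph_adj, C.joins_insert_iff u v]

variable [NeZero n]

theorem label_stripFree_mem_label_strand (x : StripPt) :
    label n (C.stripFree x) ∈ label n '' C.strand m := by
  by_cases h : label 1 x = label 1 (0, false)
  · exact ⟨_, C.base_mem_strand m, (C.label_stripFree_eq h).symm⟩
  · exact ⟨_, C.stripFree_strandEnd_mem_strand m,
      C.label_stripFree_eq (label_one_eq_of_ne_of_ne (C.label_strandEnd_ne m) h)⟩

/-- The closed curve on the Klein bottle that contains the inserted arc. -/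
noncomputable def insertedCurve (u : Connection 1) : ClosedCurve (C.insert u) m :=
  (glueGraph (C.insert u) m).connectedComponentMk (label n C.base)

theorem insertedCurve_supp (u : Connection 1) :
    (C.insertedCurve m u).supp = label n '' C.strand m := by
  have hbase : label n C.base ∈ (C.insertedCurve m u).supp :=
    SimpleGraph.ConnectedComponent.connectedComponentMk_mem
  apply Set.Subset.antisymm
  · refine ClosedCurve.supp_subset _ ?_ ?_ hbase ⟨_, C.base_mem_strand m, rfl⟩
    all_goals
      intro p hp
      obtain ⟨q, hq, hqp⟩ := hp
      obtain ⟨k, rfl⟩ := label_eq_label_iff.1 hqp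
      rw [Connection.mate_zpow, label_zpow]
    · rcases C.exists_stripFree_or q with ⟨x, rfl⟩ | h
      · rw [insert_mate_stripFree]
        exact C.label_stripFree_mem_label_strand m _
      · rw [C.insert_mate_of_ne u h]
        exact ⟨_, (C.stripCup_mem_strand_iff m).2 hq, rfl⟩
    · exact ⟨_, (C.mate_mem_strand_iff m).2 hq, rfl⟩
  · refine Set.image_subset_iff.2 (C.strand_subset m (fun p => ?_) (fun p => ?_) hbase)
    · rcases C.exists_stripFree_or p with ⟨x, rfl⟩ | h
      · rw [C.stripCup_stripFree]
      · rw [← C.insert_mate_of_ne u h]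
        exact ClosedCurve.label_left_mate_mem_supp_iff _
    · exact ClosedCurve.label_right_mate_mem_supp_iff _

theorem stripCup_ne_of_ne_insertedCurve {u : Connection 1} {c : ClosedCurve (C.insert u) m}
    (hc : c ≠ C.insertedCurve m u) {p : StripPt} (hp : label n p ∈ c.supp) :
    C.stripCup p ≠ p := by
  intro h
  obtain ⟨x, rfl⟩ := C.stripCup_eq_self_iff.1 h
  have hx := C.label_stripFree_mem_label_strand m x
  rw [← C.insertedCurve_supp m u] at hx
  exact hc (SimpleGraph.ConnectedComponent.eq_of_common_vertex hp hx)

theorem typeOn_insert_congr {u : Connection 1} (v : Connection 1)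
    {c : ClosedCurve (C.insert u) m} (hc : c ≠ C.insertedCurve m u) :
    typeOn (C.insert u) m c.supp = typeOn (C.insert v) m c.supp :=
  typeOn_congr_left
    (fun p hp => by
      have h := C.stripCup_ne_of_ne_insertedCurve m hc hp
      rw [C.insert_mate_of_ne u h, C.insert_mate_of_ne v h])
    (fun _ hp => c.label_right_mate_mem_supp_iff.2 (c.label_left_mate_mem_supp_iff.2 hp))

theorem exists_form_insert : ∃ R : MvPolynomial CurveType ℤ, ∀ u : Connection 1,
    form (C.insert u) m = MvPolynomial.X (typeOn (C.insert u) m (label n '' C.strand m)) * R := by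
  classical
  refine ⟨∏ c ∈ Finset.univ.erase (C.insertedCurve m crossArc),
    MvPolynomial.X (typeOn (C.insert crossArc) m c.supp), fun u => ?_⟩
  rw [form_eq_prod (C.glueGraph_insert m u crossArc),
    ← Finset.mul_prod_erase _ _ (Finset.mem_univ (C.insertedCurve m crossArc)),
    C.insertedCurve_supp m crossArc]
  congr 1
  refine Finset.prod_congr rfl fun c hc => ?_
  rw [C.typeOn_insert_congr m u (Finset.ne_of_mem_erase hc)]

theorem insert_mate_mem_strand_iff {u : Connection 1} (hu : u.mate (0, false) = C.strandEnd m)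
    {p : StripPt} : (C.insert u).mate p ∈ C.strand m ↔ p ∈ C.strand m := by
  rcases C.exists_stripFree_or p with ⟨x, rfl⟩ | h
  · rw [insert_mate_stripFree, stripFree_mem_strand_iff, stripFree_mem_strand_iff, ← hu,
      u.mate_involutive.eq_iff, u.mate_involutive.injective.eq_iff, or_comm, eq_comm,
      @eq_comm _ (0, false)]
  · rw [C.insert_mate_of_ne u h, stripCup_mem_strand_iff]

theorem liftsClosedOn_of_mate_eq_strandEnd {u : Connection 1}
    (hu : u.mate (0, false) = C.strandEnd m) :
    LiftsClosedOn (C.insert u) m (label n '' C.strand m) := by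
  rintro p ⟨q, hq, hqp⟩
  obtain ⟨k, rfl⟩ := label_eq_label_iff.1 hqp
  have hmaps : Set.MapsTo (m.mate ∘ (C.insert u).mate) (C.strand m) (C.strand m) := fun x hx =>
    (C.mate_mem_strand_iff m).2 ((C.insert_mate_mem_strand_iff m hu).2 hx)
  refine Function.Semiconj.mapsTo_periodicPts (g := deckPerm n ^ k) (fun x => ?_)
    (mem_periodicPts_of_finite (C.strand_finite m) hmaps
      (m.mate_involutive.injective.comp (C.insert u).mate_involutive.injective) hq)
  simp only [Function.comp_apply, Connection.mate_zpow]

theorem exists_zpow_strandEnd_eq_mate (u : Connection 1) :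
    ∃ k : ℤ, (deckPerm 1 ^ k) (C.strandEnd m) = u.mate (0, false) :=
  label_eq_label_iff.1 (label_one_eq_of_ne_of_ne (C.label_strandEnd_ne m) (u.label_mate_ne _))

/-- If the closed lift of the curve contains a translate `δ P` of the far end `P` of the strand,
then it contains `δ` of the start of the strand too, so that `δ` permutes its finitely many
points. -/
theorem mate_eq_strandEnd_of_liftsClosedOn {u : Connection 1}
    (hu : LiftsClosedOn (C.insert u) m (label n '' C.strand m)) :
    u.mate (0, false) = C.strandEnd m := by
  obtain ⟨k, hk⟩ := C.exists_zpow_strandEnd_eq_mate m u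
  obtain ⟨N, hN, hperiodic⟩ := hu C.base ⟨_, C.base_mem_strand m, rfl⟩
  set lift := alternatingOrbit m.matePerm (C.insert u).matePerm C.base
  have hinsert (p : StripPt) : (C.insert u).mate p ∈ lift ↔ p ∈ lift :=
    apply_right_mem_alternatingOrbit_iff m.mate_involutive (C.insert u).mate_involutive
  have hcup (p : StripPt) : C.stripCup p ∈ lift ↔ p ∈ lift := by
    rcases C.exists_stripFree_or p with ⟨x, rfl⟩ | h
    · rw [C.stripCup_stripFree]
    · rw [← C.insert_mate_of_ne u h, hinsert]
  have hend : (deckPerm n ^ k) (C.stripFree (C.strandEnd m)) ∈ lift := by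
    rw [← C.stripFree_zpow, hk, ← C.insert_mate_stripFree, hinsert]
    exact mem_alternatingOrbit_self _ _ _
  have hbase : (deckPerm n ^ k) C.base ∈ lift :=
    C.zpow_mem_of_mem_strand m hcup (fun _ => apply_left_mem_alternatingOrbit_iff m.mate_involutive)
      (C.stripFree_strandEnd_mem_strand m) (C.base_mem_strand m) hend
  have hpow : ((m.matePerm * (C.insert u).matePerm) ^ N) C.base = C.base := by
    rw [← Equiv.Perm.iterate_eq_pow]
    exact hperiodic
  have hfix : ((deckPerm n ^ k) ^ (2 * N)) C.base = C.base :=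
    pow_two_mul_apply_eq_self_of_mem_alternatingOrbit m.mate_involutive
      (C.insert u).mate_involutive (m.commute_deckPerm_zpow_matePerm k)
      ((C.insert u).commute_deckPerm_zpow_matePerm k) hpow hbase
  rw [← zpow_natCast, ← zpow_mul] at hfix
  have hzero : k = 0 := by
    simpa [hN.ne'] using eq_zero_of_deckPerm_zpow_eq_self hfix
  rw [← hk, hzero, zpow_zero, Equiv.Perm.one_apply]

theorem typeOn_insert_crossArc :
    typeOn (C.insert crossArc) m (label n '' C.strand m) =
      if (C.strandEnd m).2 then .w else .x := by
  rw [typeOn, C.ncard_crosses_insert_crossArc m, if_pos (by decide)]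
  simp only [C.odd_outer_crossings_iff m]

theorem typeOn_insert_sideArc (b : Bool) :
    typeOn (C.insert (sideArc b)) m (label n '' C.strand m) =
      if (C.strandEnd m).2 then .y
      else if (sideArc b).mate (0, false) = C.strandEnd m then .d else .z := by
  have hlifts : LiftsClosedOn (C.insert (sideArc b)) m (label n '' C.strand m) ↔
      (sideArc b).mate (0, false) = C.strandEnd m :=
    ⟨C.mate_eq_strandEnd_of_liftsClosedOn m, C.liftsClosedOn_of_mate_eq_strandEnd m⟩
  rw [typeOn, C.ncard_crosses_insert_sideArc m, if_neg (by decide)]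
  simp only [C.odd_outer_crossings_iff m, hlifts]

open MvPolynomial in
theorem dvd_form_insert_combination :
    (X .w * (X .d + X .z) - 2 * (X .x * X .y) : MvPolynomial CurveType ℤ) ∣
      (X .d + X .z) * form (C.insert crossArc) m -
        X .x * (form (C.insert (sideArc false)) m + form (C.insert (sideArc true)) m) := by
  obtain ⟨R, hR⟩ := C.exists_form_insert m
  rw [hR, hR, hR, typeOn_insert_crossArc, typeOn_insert_sideArc, typeOn_insert_sideArc]
  cases hside : (C.strandEnd m).2
  · have hright : (sideArc false).mate (0, false) = (1, false) := rfl
    have hleft : (sideArc true).mate (0, false) = (-1, false) := rfl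
    have hne : ((1, false) : StripPt) ≠ (-1, false) := by decide
    rw [hright, hleft]
    rcases C.strandEnd_fst_of_snd_eq_false m hside with h | h <;> rw [h]
    · exact ⟨0, by simp only [hne.symm, Bool.false_eq_true, if_false, if_true]; ring⟩
    · exact ⟨0, by simp only [hne, Bool.false_eq_true, if_false, if_true]; ring⟩
  · exact ⟨R, by simp only [if_true]; ring⟩

end CupSystem

/-! ### The rows of the Gram matrix -/

namespace CupSystem

variable (C : CupSystem n)

theorem insert_crossArc_mate_snd_eq_iff (p : StripPt) :
    ((C.insert crossArc).mate p).2 = p.2 ↔ C.stripCup p ≠ p := by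
  rw [← not_iff_not, ← ne_eq, insert_mate_snd_ne_iff, not_ne_iff, stripCup_eq_self_iff]
  simp only [crossArc_mate_snd_ne, ne_eq, not_false_eq_true, and_true]

theorem insert_sideArc_ne_insert_crossArc (D : CupSystem n) (b : Bool) :
    D.insert (sideArc b) ≠ C.insert crossArc := by
  intro h
  have hcross : ((D.insert (sideArc b)).mate C.base).2 ≠ C.base.2 := by
    rw [h]
    exact (C.insert_mate_snd_ne_iff _ _).2 ⟨_, rfl, crossArc_mate_snd_ne _⟩
  obtain ⟨x, -, hx⟩ := (D.insert_mate_snd_ne_iff _ _).1 hcross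
  exact hx rfl

theorem cup_eq_of_insert_crossArc_eq {C D : CupSystem n}
    (h : C.insert crossArc = D.insert crossArc) : C.cup = D.cup := by
  funext i
  have hiff : C.stripCup (i, false) ≠ (i, false) ↔ D.stripCup (i, false) ≠ (i, false) := by
    rw [← insert_crossArc_mate_snd_eq_iff, h, insert_crossArc_mate_snd_eq_iff]
  suffices hstrip : C.stripCup (i, false) = D.stripCup (i, false) from congrArg Prod.fst hstrip
  by_cases hC : C.stripCup (i, false) = (i, false)
  · rw [hC, not_ne_iff.1 (hiff.not.1 (not_ne_iff.2 hC))]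
  · rw [← C.insert_mate_of_ne crossArc hC, h, D.insert_mate_of_ne crossArc (hiff.1 hC)]

end CupSystem

open Classical in
/-- The connections that consist of an arc through the crosscap and of arcs below the graph of a
lattice path. They index the rows of the Gram matrix that are replaced by combinations of rows
divisible by `w (d + z) - 2 x y`. -/
noncomputable def crossRows (n : ℕ) [NeZero n] : Finset (Connection n) :=
  Finset.univ.image fun S : upSets n => (upSetPath S).toCupSystem.insert crossArc

theorem mem_crossRows [NeZero n] {m : Connection n} :
    m ∈ crossRows n ↔ ∃ S : upSets n, (upSetPath S).toCupSystem.insert crossArc = m := by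
  simp only [crossRows, Finset.mem_image, Finset.mem_univ, true_and]

theorem card_crossRows [NeZero n] : (crossRows n).card = (2 * n).choose (n - 1) := by
  classical
  rw [crossRows, Finset.card_image_of_injective, Finset.card_univ, card_upSets]
  exact fun S S' h => cup_upSetPath_injective (CupSystem.cup_eq_of_insert_crossArc_eq h)

open MvPolynomial Matrix

theorem exists_dvd_row_combination [NeZero n] {m : Connection n} (hm : m ∈ crossRows n) :
    ∃ L : Connection n → MvPolynomial CurveType ℤ, (∀ j ∈ crossRows n, L j = 0) ∧ ∀ j,
      (X .w * (X .d + X .z) - 2 * (X .x * X .y) : MvPolynomial CurveType ℤ) ∣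
        (X .d + X .z) * gramMatrix n m j - (L ᵥ* gramMatrix n) j := by
  classical
  obtain ⟨S, rfl⟩ := mem_crossRows.1 hm
  set C := (upSetPath S).toCupSystem
  refine ⟨Pi.single (C.insert (sideArc false)) (X .x) + Pi.single (C.insert (sideArc true)) (X .x),
    fun j hj => ?_, fun j => ?_⟩
  · obtain ⟨S', rfl⟩ := mem_crossRows.1 hj
    simp [(CupSystem.insert_sideArc_ne_insert_crossArc _ _ _).symm]
  · rw [add_vecMul, Pi.add_apply, single_vecMul, single_vecMul]
    simpa [gramMatrix, mul_add] using C.dvd_form_insert_combination j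

theorem factor_pow_dvd_pow_mul_gramDet [NeZero n] :
    (X .w * (X .d + X .z) - 2 * (X .x * X .y) : MvPolynomial CurveType ℤ) ^
        (2 * n).choose (n - 1) ∣
      (X .d + X .z) ^ (2 * n).choose (n - 1) * gramDet n := by
  classical
  rw [← card_crossRows, gramDet]
  exact pow_card_dvd_pow_card_mul_det (gramMatrix n) (crossRows n) _ _ fun m hm =>
    exists_dvd_row_combination hm

end KleinGram

theorem mainTheorem5 (n : ℕ) [NeZero n] :
    (MvPolynomial.X KleinGram.CurveType.w *
          (MvPolynomial.X KleinGram.CurveType.d + MvPolynomial.X KleinGram.CurveType.z) -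
        2 * (MvPolynomial.X KleinGram.CurveType.x * MvPolynomial.X KleinGram.CurveType.y)) ^
        Nat.choose (2 * n) (n - 1) ∣
      KleinGram.gramDet n :=
  KleinGram.isRelPrime_factor_d_add_z.pow.dvd_of_dvd_mul_left
    KleinGram.factor_pow_dvd_pow_mul_gramDet
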